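/- **Setting.** In correlation clustering the input is a simple graph $G=(V,E)$ with $|V|=n$, whose edges are the similar pairs; all other pairs are dissimilar. The cost of a partition of $V$ (a clustering) is the number of pairs that are similar and separated, or dissimilar and in the same cluster; $\mathrm{OPT}$ is the minimum cost. All logarithms are to base $2$. The graph $G$ is fixed, and its edges are revealed one by one, each exactly once, in an adaptive order: each next edge is chosen by an adversary among the unrevealed edges as an arbitrary function of the revealed edges and of all states of the algorithm so far (hence of all coins flipped so far). A word has $\lfloor\log n\rfloor+1$ bits. **Algorithm** (parameters $\varepsilon$ and constants $c$, $a$). Let $\theta_0=\lceil \frac{4c}{\varepsilon}\log n\rceil$, $\theta_j=2\theta_{j-1}$, and let the degree classes be $C_0=[0,\theta_0]$, $C_j=[\theta_{j-1}+1,\theta_j]$ for $j\ge1$. Initially all nodes are interesting and have an empty rank $r_u$. When an edge is revealed, both endpoints update their degree (the number of incident edges revealed so far). An endpoint $u$ whose degree class changes flips a fair coin in $\{0,1\}$, independent of everything before, and appends it to $r_u$; on $1$ it becomes uninteresting for good and deletes its copies of its incident edges. Interesting nodes keep copies of all their revealed incident edges, uninteresting nodes keep none. After the stream, each $r_u$ is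 completed by independent fair coins to length $\lceil a\log n\rceil$. Let $\pi_u\in\{1,\dots,n\}$ be the position of $u$ when the nodes are sorted lexicographically by rank (ties broken by node identifiers), and $\tau_u=\frac c\varepsilon\cdot\frac{n\log n}{\deg(u)}$, with $\tau_u=\infty$ if $\deg(u)=0$. All nodes with $\pi_u\ge\tau_u$ also become uninteresting and delete their copies of edges. The pivots are the output of greedy MIS, in the order $\pi$, on the graph induced by the interesting nodes. Each node $v$ that is not a pivot and has a pivot neighbour joins the cluster of its pivot neighbour $u$ with smallest $\pi_u$, if $\pi_u<\tau_v$. Each remaining non-pivot node forms a singleton cluster. **Theorem.** For every integer $k\ge0$, if the constants $c$ and $a$ ($c$ real, $a$ a positive integer) are sufficiently large depending only on $k$, then there is a constant $K$ depending only on $k,c,a$ such that for every $\varepsilon\in(0,1/4)$, every graph $G$ on $n\ge2$ nodes and every adaptive-order stream of its edges, the algorithm above, which makes a single pass over the stream, satisfies the following. 1. It is a $(3+\varepsilon)$-approximation in expectation: its output has expected cost at most $(3+\varepsilon)\cdot\mathrm{OPT}$ if $\mathrm{OPT}\ge1$, and at most $n^{-k}$ if $\mathrm{OPT}=0$. 2.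 With probability at least $1-n^{-k}$, the algorithm stores at most $K\cdot\frac{n\log n}{\varepsilon}$ words at all times, during and after the stream. -/

import Mathlib

namespace CorrClust

noncomputable section

open scoped Classical

/-! ### Correlation clustering -/

/-- Number of disagreements of the clustering `s` on the complete signed graph whose positive
edges are the edges of `G`: the unordered pairs (counted once, as `u < v`) that are positive and
separated, or negative and in the same cluster. -/
def cost {n : ℕ} (G : SimpleGraph (Fin n)) (s : Setoid (Fin n)) : ℕ :=
  (Finset.univ.filter fun p : Fin n × Fin n =>
    p.1 < p.2 ∧ ¬ (G.Adj p.1 p.2 ↔ s.r p.1 p.2)).card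

/-- The minimum number of disagreements over all clusterings. -/
def opt {n : ℕ} (G : SimpleGraph (Fin n)) : ℕ :=
  ⨅ s : Setoid (Fin n), cost G s

/-! ### Parameters of the algorithm -/

/-- The approximation parameter `ε` and the constants `c`, `a` of the algorithm. -/
structure Params where
  ε : ℝ
  c : ℝ
  a : ℕ

/-- `θ_0 = ⌈(4c/ε) log n⌉`; logarithms are to base 2. -/
def Params.theta0 (P : Params) (n : ℕ) : ℕ := ⌈4 * P.c / P.ε * Real.logb 2 n⌉₊

/-- `θ_j = 2 θ_{j-1}`. -/
def Params.theta (P : Params) (n : ℕ) : ℕ → ℕ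
  | 0 => P.theta0 n
  | j + 1 => 2 * P.theta n j

/-- The index `j` of the degree class `C_j` containing `d`, where `C_0 = [0, θ_0]` and
`C_j = [θ_{j-1} + 1, θ_j]` for `j ≥ 1`. -/
def Params.degClass (P : Params) (n d : ℕ) : ℕ := sInf {j | d ≤ P.theta n j}

/-- Length of the rank bit strings, `a log n` rounded up. -/
def Params.len (P : Params) (n : ℕ) : ℕ := ⌈(P.a : ℝ) * Real.logb 2 n⌉₊

/-- `p < τ` for a node of degree `d`, where `τ = (c/ε) (n log n) / d`. It is cleared of the
denominator, so that `τ = ∞` for `d = 0`. -/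
def Params.below (P : Params) (n p d : ℕ) : Prop :=
  (p : ℝ) * d < P.c / P.ε * (n * Real.logb 2 n)

/-! ### Memory -/

/-- What the algorithm keeps for a node: the number of incident edges revealed so far, the bits of
the rank chosen so far (`false` is `0`, `true` is `1`), whether the node is still interesting, its
copies of incident edges (given by the other endpoints), its position in the permutation, whether
it is a pivot, and the name of its cluster. -/
structure NodeMem (n : ℕ) where
  deg : ℕ
  rank : List Bool
  interesting : Bool
  nbrs : Finset (Fin n)
  pos : ℕ
  pivot : Bool
  label : Fin n

abbrev Memory (n : ℕ) := Fin n → NodeMem n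

/-- Initially every node is interesting, has degree `0` and an empty rank. -/
def initMem (n : ℕ) : Memory n := fun u => ⟨0, [], true, ∅, 0, false, u⟩

/-- Number of bits in a word; a word can hold any number in `{0, …, n}`. -/
def wordBits (n : ℕ) : ℕ := Nat.log 2 n + 1

/-- Number of words used for a node: two for each of its copies of edges (both endpoints of the
edge), the packed bits of the rank, and one word for each of the five remaining fields. -/
def NodeMem.words {n : ℕ} (x : NodeMem n) : ℕ :=
  2 * x.nbrs.card + ⌈(x.rank.length : ℚ) / wordBits n⌉₊ + 5

/-- Number of words in memory; two words hold the edge that is currently being read. -/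
def words {n : ℕ} (m : Memory n) : ℕ := 2 + ∑ u, (m u).words

/-! ### First phase: the stream -/

/-- All coin flips: for each node, the bits of its rank in the order in which it flips them. They
are independent and fair, i.e. the tape is uniformly distributed. -/
abbrev Tape (P : Params) (n : ℕ) := Fin n → Fin (P.len n) → Bool

/-- The `i`-th coin that node `u` flips. (A node never switches degree classes `P.len n` times or
more when `a` and `c` are large enough, so the default value is then not used.) -/
def coin {P : Params} {n : ℕ} (ω : Tape P n) (u : Fin n) (i : ℕ) : Bool :=
  if h : i < P.len n then ω u ⟨i, h⟩ else false

/-- A node receives an incident edge with other endpoint in `new` (a singleton). If its degree class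
switches, then the coin `b` is the next bit of its rank, and on `1` it becomes uninteresting. Only
interesting nodes keep copies of their incident edges. -/
def NodeMem.receive {n : ℕ} (P : Params) (b : Bool) (new : Finset (Fin n)) (x : NodeMem n) :
    NodeMem n :=
  let switch : Bool := decide (P.degClass n (x.deg + 1) ≠ P.degClass n x.deg)
  let stays : Bool := x.interesting && !(switch && b)
  { x with
    deg := x.deg + 1
    rank := if switch then x.rank ++ [b] else x.rank
    interesting := stays
    nbrs := if stays then x.nbrs ∪ new else ∅ }

/-- Processing of one revealed edge: both endpoints receive it. -/
def step {P : Params} {n : ℕ} (ω : Tape P n) (e : Sym2 (Fin n)) (m : Memory n) : Memory n :=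
  fun u =>
    if u ∈ e then
      (m u).receive P (coin ω u (m u).rank.length) (Finset.univ.filter fun v => e = s(u, v))
    else m u

/-- What has happened so far, latest event first: each revealed edge, together with the complete
state of the algorithm after that edge was processed (including all coins flipped so far). -/
abbrev History (n : ℕ) := List (Sym2 (Fin n) × Memory n)

/-- The edges revealed so far. -/
def History.revealed {n : ℕ} (h : History n) : List (Sym2 (Fin n)) := h.map Prod.fst

/-- An adaptive-order stream of the edges of the fixed graph `G`: as long as there are unrevealed
edges, the next one is chosen among them as an arbitrary function of the history. -/
structure Adversary {n : ℕ} (G : SimpleGraph (Fin n)) where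
  next : History n → Sym2 (Fin n)
  next_spec : ∀ h : History n, (∃ e ∈ G.edgeSet, e ∉ h.revealed) →
    next h ∈ G.edgeSet ∧ next h ∉ h.revealed

/-- History and memory after `t` edges. -/
def stream {P : Params} {n : ℕ} {G : SimpleGraph (Fin n)} (adv : Adversary G) (ω : Tape P n) :
    ℕ → History n × Memory n
  | 0 => ([], initMem n)
  | t + 1 =>
    let past := stream adv ω t
    let e := adv.next past.1
    let m := step ω e past.2
    ((e, m) :: past.1, m)

/-! ### Second phase: after the stream -/

/-- Each node flips the coins for the remaining bits of its rank. -/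
def fillRanks {P : Params} {n : ℕ} (ω : Tape P n) (m : Memory n) : Memory n :=
  fun u => { m u with rank := (m u).rank ++ (List.ofFn (ω u)).drop (m u).rank.length }

/-- The number with binary digits `l`, most significant digit first. -/
def rankValue (l : List Bool) : ℕ := l.foldl (fun x b => 2 * x + b.toNat) 0

/-- Each node learns its position in `{1, …, n}` in the order of the ranks. Ties, if there are any,
are broken by the names of the nodes. -/
def setPositions {n : ℕ} (m : Memory n) : Memory n :=
  fun u => { m u with
    pos := (Finset.univ.filter fun v : Fin n =>
      rankValue (m v).rank < rankValue (m u).rank ∨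
        rankValue (m v).rank = rankValue (m u).rank ∧ v ≤ u).card }

/-- The nodes `u` with `π_u ≥ τ_u` become uninteresting, too, and delete their edges. -/
def prune {n : ℕ} (P : Params) (m : Memory n) : Memory n :=
  fun u =>
    let stays : Bool := (m u).interesting && decide (P.below n (m u).pos (m u).deg)
    { m u with
      interesting := stays
      nbrs := if stays then (m u).nbrs else ∅ }

/-- One step of greedy MIS on the graph induced by the interesting nodes: the node at position `i`
becomes a pivot if it is interesting and no neighbour of it is a pivot. -/
def misStep {n : ℕ} (i : ℕ) (m : Memory n) : Memory n :=
  fun u => { m u with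
    pivot := (m u).pivot ||
      decide ((m u).pos = i ∧ (m u).interesting = true ∧
        ∀ v ∈ (m u).nbrs, (m v).pivot = false) }

/-- Greedy MIS after the nodes at positions `1, …, i` were processed. -/
def mis {n : ℕ} (m : Memory n) : ℕ → Memory n
  | 0 => m
  | i + 1 => misStep (i + 1) (mis m i)

/-- `u` is the pivot neighbour of `v` of smallest rank. The edges between `v` and the pivots are
found in the memory of the pivots. -/
def IsFirstPivot {n : ℕ} (m : Memory n) (v u : Fin n) : Prop :=
  ((m u).pivot = true ∧ v ∈ (m u).nbrs) ∧
    ∀ w, (m w).pivot = true → v ∈ (m w).nbrs → (m u).pos ≤ (m w).pos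

/-- Each node `v` that is not a pivot joins the cluster of its pivot neighbour `u` of smallest rank
if `π_u < τ_v`. All other nodes keep their own name as the name of their cluster. -/
def join {n : ℕ} (P : Params) (m : Memory n) : Memory n :=
  fun v => { m v with
    label :=
      if h : (m v).pivot = false ∧ ∃ u, IsFirstPivot m v u ∧ P.below n (m u).pos (m v).deg
      then h.2.choose else v }

/-! ### The complete run -/

section Run

variable {P : Params} {n : ℕ} {G : SimpleGraph (Fin n)} (adv : Adversary G) (ω : Tape P n)

/-- The memory when all edges have been revealed. -/
def endOfStream : Memory n := (stream adv ω G.edgeFinset.card).2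

/-- The memory when the set of interesting nodes has been completed. -/
def pruned : Memory n := prune P (setPositions (fillRanks ω (endOfStream adv ω)))

/-- The memory at the end. -/
def final : Memory n := join P (mis (pruned adv ω) n)

/-- The returned clustering: two nodes are in the same cluster if they have the same label. -/
def output : Setoid (Fin n) := Setoid.ker fun v => (final adv ω v).label

/-- All successive states of the memory. -/
def trace : List (Memory n) :=
  (List.range (G.edgeFinset.card + 1)).map (fun t => (stream adv ω t).2) ++
  [fillRanks ω (endOfStream adv ω), setPositions (fillRanks ω (endOfStream adv ω))] ++
  (List.range (n + 1)).map (fun i => mis (pruned adv ω) i) ++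
  [final adv ω]

end Run

/-! ### Uniform probability -/

/-- Expectation of `f` under the uniform distribution on a finite type. -/
def expectation {Ω : Type*} [Fintype Ω] (f : Ω → ℝ) : ℝ := (∑ ω, f ω) / Fintype.card Ω

/-- Probability of `E` under the uniform distribution on a finite type. -/
def probability {Ω : Type*} [Fintype Ω] (E : Ω → Prop) : ℝ :=
  ((Finset.univ.filter E).card : ℝ) / Fintype.card Ω

end

end CorrClust

/-! Cost and memory are analysed separately, because the adversary influences only the memory.

Cost. When the stream ends, the state depends on the coins and on `G`, not on the order of the edges
(`endOfStream_eq`): the first bits of a rank are the coins that decided whether the node stays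
interesting. Suppose that every node with π < τ is still interesting (`EarlyInteresting`). This
holds with high probability: a node that flipped a 1 comes after all nodes whose corresponding
prefix is zero, and a Chernoff bound says that these are many. Then the output is that of a
sequential pivot process in which a node v also leaves, as a singleton, at its deadline τ_v
(`final_label`). Without ties its order is uniform (`sum_order`).

The disagreements of this process are of two kinds (`disagreement_cases`). Those charged to a pivot
belong to bad triples, that is, three nodes spanning exactly two edges. The chance that a bad triple
is hit by a pivot while all its nodes are unclustered is the same for each of the three nodes as
pivot. A pair is charged at most once and never if one of its nodes comes first, and every
clustering errs on each bad triple. This fractional packing bounds the expected charged cost by 3(1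
− 2/n)·OPT (`sum_card_chargedPairs_le`). The others are edges from a timed-out node to neighbours
unclustered just before its deadline. With high probability these are at most an ε/20 fraction of
its degree, and all edges at a timed-out node are cut, so this part is an ε/10 fraction of the cost
(`cost_lab_le`). The slack 2/n pays for the failure events, so no additive term remains if OPT ≥ 1.

Memory. Here adaptivity matters, and independence between nodes is replaced by a martingale: the
product over the nodes of 1 + [interesting]·(θ_0/n)·2^class. A class switch doubles the second
summand or kills it with equal chances, whatever the adversary does (`sum_prod_weight`). The product
dominates the exponential of the number of copies divided by 2n, so Markov's inequality applies at
each time (`card_heavy_le`), and a union bound over all times finishes. -/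

namespace CorrClust

noncomputable section

open scoped Classical
open Finset

/-! ### The sequential pivot process with deadlines and its disagreements -/

section Greedy

variable {n : ℕ} (G : SimpleGraph (Fin n)) (T : Fin n → ℕ) (σ : Equiv.Perm (Fin n))

/-- The nodes that are still unclustered before position `t` is processed by sequential greedy
clustering in the order `σ`, where the node `v` leaves at time `T v` at the latest. -/
def alive : ℕ → Finset (Fin n)
  | 0 => univ.filter fun v => 0 < T v
  | t + 1 => (alive t).filter fun v =>
      t + 1 < T v ∧ ∀ w ∈ alive t, (σ w : ℕ) = t → ¬ (v = w ∨ G.Adj w v)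

def IsPivot (w : Fin n) : Prop := w ∈ alive G T σ (σ w)

/-- The node `v` joins the cluster of the pivot `w`. -/
def Hits (w v : Fin n) : Prop :=
  IsPivot G T σ w ∧ v ∈ alive G T σ (σ w) ∧ (v = w ∨ G.Adj w v)

/-- The name of the cluster of `v`. -/
def lab (v : Fin n) : Fin n := if h : ∃ w, Hits G T σ w v then h.choose else v

/-- Three distinct nodes that span exactly two edges. -/
def BadTriple (w x y : Fin n) : Prop :=
  (w ≠ x ∧ w ≠ y ∧ x ≠ y) ∧
    ((G.Adj w x ∧ G.Adj w y ∧ ¬ G.Adj x y) ∨ (G.Adj w x ∧ ¬ G.Adj w y ∧ G.Adj x y) ∨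
      (¬ G.Adj w x ∧ G.Adj w y ∧ G.Adj x y))

/-- The bad triple `w, x, y` is unclustered when the pivot `w` is processed. -/
def Charged (w x y : Fin n) : Prop :=
  BadTriple G w x y ∧ IsPivot G T σ w ∧ x ∈ alive G T σ (σ w) ∧ y ∈ alive G T σ (σ w)

/-- Such a node is not a pivot, since pivots hit themselves, and it ends as a singleton
(`TimedOut.lab_ne`). -/
def TimedOut (x : Fin n) : Prop := ¬ ∃ w, Hits G T σ w x

variable {G T σ}

lemma mem_alive {t : ℕ} {v : Fin n} : v ∈ alive G T σ t ↔
    t < T v ∧ ∀ w, IsPivot G T σ w → (σ w : ℕ) < t → ¬ (v = w ∨ G.Adj w v) := by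
  induction t with
  | zero => simp [alive]
  | succ t ih =>
    rw [alive, mem_filter, ih]
    constructor
    · rintro ⟨⟨h1, h2⟩, h3, h4⟩
      refine ⟨h3, fun w hw hlt => ?_⟩
      rcases Nat.lt_succ_iff_lt_or_eq.1 hlt with h | h
      · exact h2 w hw h
      · exact h4 w (by rw [← h]; exact hw) h
    · rintro ⟨h1, h2⟩
      refine ⟨⟨by omega, fun w hw hlt => h2 w hw (by omega)⟩, h1, fun w hw he => ?_⟩
      exact h2 w (by unfold IsPivot; rwa [he]) (by omega)

lemma alive_anti {s t : ℕ} (h : s ≤ t) {v : Fin n} (hv : v ∈ alive G T σ t) :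
    v ∈ alive G T σ s := by
  rw [mem_alive] at hv ⊢
  exact ⟨by omega, fun w hw hlt => hv.2 w hw (by omega)⟩

lemma alive_congr {σ' : Equiv.Perm (Fin n)} {t : ℕ}
    (h : ∀ w, (σ w : ℕ) < t ∨ (σ' w : ℕ) < t → σ w = σ' w) :
    alive G T σ t = alive G T σ' t := by
  induction t with
  | zero => rfl
  | succ t ih =>
    have ih' := ih fun w hw => h w (by omega)
    rw [alive, alive, ih']
    refine filter_congr fun v _ => and_congr_right fun _ => forall₂_congr fun w _ => ?_
    have : (σ w : ℕ) = t ↔ (σ' w : ℕ) = t := by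
      constructor <;> intro hw
      · rw [← h w (by omega), hw]
      · rw [h w (by omega), hw]
    rw [this]

lemma le_of_mem_alive {t : ℕ} {v : Fin n} (hv : v ∈ alive G T σ t) : t ≤ σ v := by
  by_contra! h
  exact (mem_alive.1 hv).2 v (alive_anti h.le hv) h (Or.inl rfl)

lemma Hits.unique {w w' v : Fin n} (h : Hits G T σ w v) (h' : Hits G T σ w' v) : w = w' := by
  rcases lt_trichotomy (σ w : ℕ) (σ w') with hlt | heq | hlt
  · exact absurd h.2.2 ((mem_alive.1 h'.2.1).2 w h.1 hlt)
  · exact σ.injective (Fin.ext heq)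
  · exact absurd h'.2.2 ((mem_alive.1 h.2.1).2 w' h'.1 hlt)

lemma IsPivot.hits {v : Fin n} (h : IsPivot G T σ v) : Hits G T σ v v := ⟨h, h, Or.inl rfl⟩

lemma Hits.lab_eq {w v : Fin n} (h : Hits G T σ w v) : lab G T σ v = w := by
  have h' : ∃ w, Hits G T σ w v := ⟨w, h⟩
  rw [lab, dif_pos h']
  exact h'.choose_spec.unique h

lemma TimedOut.lab_eq {v : Fin n} (h : TimedOut G T σ v) : lab G T σ v = v := dif_neg h

/-- If v is no longer unclustered when w is processed although its deadline has not passed, then an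
earlier pivot took it. Descent on the position of the pivot stops at the one that v joins. -/
lemma exists_hits {w v : Fin n} (hw : IsPivot G T σ w) (hadj : v = w ∨ G.Adj w v)
    (hlt : (σ w : ℕ) < T v) : ∃ w', Hits G T σ w' v := by
  induction hk : (σ w : ℕ) using Nat.strong_induction_on generalizing w with
  | _ k ih =>
    by_cases hv : v ∈ alive G T σ (σ w)
    · exact ⟨w, hw, hv, hadj⟩
    · rw [mem_alive] at hv
      push Not at hv
      obtain ⟨w', h1, h2, h3⟩ := hv hlt
      exact ih (σ w') (by omega) h1 h3 (by omega) rfl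

lemma TimedOut.mem_alive {v : Fin n} (h : TimedOut G T σ v) {t : ℕ} (ht : t < T v) :
    v ∈ alive G T σ t := by
  rw [CorrClust.mem_alive]
  exact ⟨ht, fun w hw hlt hadj => h (exists_hits hw hadj (by omega))⟩

lemma Hits.charged {w x y : Fin n} (hx : Hits G T σ w x) (hy : y ∈ alive G T σ (σ w))
    (hn : ¬ Hits G T σ w y) (hadj : G.Adj x y) : Charged G T σ w x y := by
  have hy' : ¬ (y = w ∨ G.Adj w y) := fun h => hn ⟨hx.1, hy, h⟩
  push Not at hy'
  have hwx : w ≠ x := by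
    rintro rfl
    exact hy'.2 hadj
  have hadj' : G.Adj w x := hx.2.2.resolve_left (Ne.symm hwx)
  exact ⟨⟨⟨hwx, Ne.symm hy'.1, hadj.ne⟩, Or.inr (Or.inl ⟨hadj', hy'.2, hadj⟩)⟩, hx.1, hx.2.1, hy⟩

lemma BadTriple.symm_right {w x y : Fin n} (h : BadTriple G w x y) : BadTriple G w y x := by
  have := G.adj_comm x y
  unfold BadTriple at *
  grind

lemma BadTriple.symm_left {w x y : Fin n} (h : BadTriple G w x y) : BadTriple G x w y := by
  have := G.adj_comm x w
  unfold BadTriple at *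
  grind

lemma Charged.symm {w x y : Fin n} (h : Charged G T σ w x y) : Charged G T σ w y x :=
  ⟨h.1.symm_right, h.2.1, h.2.2.2, h.2.2.1⟩

/-- Every disagreement is charged to a pivot or to a node that leaves by timeout. -/
lemma disagreement_cases (hT : ∀ v, 0 < T v) {x y : Fin n} (hxy : x ≠ y)
    (h : ¬ (G.Adj x y ↔ lab G T σ x = lab G T σ y)) :
    (∃ w, Charged G T σ w x y) ∨
      (G.Adj x y ∧ TimedOut G T σ x ∧ y ∈ alive G T σ (T x - 1)) ∨
      (G.Adj y x ∧ TimedOut G T σ y ∧ x ∈ alive G T σ (T y - 1)) := by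
  -- One endpoint is clustered by w and the other times out. If w precedes the deadline of y, then y
  -- is unclustered at w and the triple is charged; otherwise x is still unclustered just before y
  -- leaves.
  have key : ∀ x y : Fin n, G.Adj x y → lab G T σ x ≠ lab G T σ y → ∀ w, Hits G T σ w x →
      TimedOut G T σ y → (∃ w, Charged G T σ w x y) ∨
        (G.Adj y x ∧ TimedOut G T σ y ∧ x ∈ alive G T σ (T y - 1)) := by
    intro x y hadj _ w hw hy
    rcases lt_or_ge (σ w : ℕ) (T y) with hlt | hge
    · exact Or.inl ⟨w, hw.charged (hy.mem_alive hlt) (fun h => hy ⟨w, h⟩) hadj⟩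
    · exact Or.inr ⟨hadj.symm, hy, alive_anti (by omega) hw.2.1⟩
  by_cases hadj : G.Adj x y
  · have hl : lab G T σ x ≠ lab G T σ y := fun e => h (iff_of_true hadj e)
    by_cases hx : ∃ w, Hits G T σ w x <;> by_cases hy : ∃ w, Hits G T σ w y
    · obtain ⟨w, hw⟩ := hx
      obtain ⟨w', hw'⟩ := hy
      have hne : w ≠ w' := by rwa [hw.lab_eq, hw'.lab_eq] at hl
      rcases le_total (σ w) (σ w') with hle | hle
      · exact Or.inl ⟨w, hw.charged (alive_anti hle hw'.2.1)
          (fun h => hne (h.unique hw')) hadj⟩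
      · exact Or.inl ⟨w', (hw'.charged (alive_anti hle hw.2.1)
          (fun h => hne (hw.unique h)) hadj.symm).symm⟩
    · obtain ⟨w, hw⟩ := hx
      rcases key x y hadj hl w hw hy with h | h
      · exact Or.inl h
      · exact Or.inr (Or.inr h)
    · obtain ⟨w, hw⟩ := hy
      rcases key y x hadj.symm hl.symm w hw hx with ⟨w, h⟩ | h
      · exact Or.inl ⟨w, h.symm⟩
      · exact Or.inr (Or.inl h)
    · have h1 := hT x
      have h2 := hT y
      -- When both endpoints time out, the one with the earlier deadline still sees the other.
      rcases le_total (T x) (T y) with hle | hle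
      · exact Or.inr (Or.inl ⟨hadj, hx, TimedOut.mem_alive hy (by omega)⟩)
      · exact Or.inr (Or.inr ⟨hadj.symm, hy, TimedOut.mem_alive hx (by omega)⟩)
  · have hl : lab G T σ x = lab G T σ y := by
      by_contra e
      exact h (iff_of_false hadj e)
    left
    by_cases hx : ∃ w, Hits G T σ w x <;> by_cases hy : ∃ w, Hits G T σ w y
    · obtain ⟨w, hw⟩ := hx
      obtain ⟨w', hw'⟩ := hy
      have hww : w = w' := by rwa [hw.lab_eq, hw'.lab_eq] at hl
      subst hww
      have hwx : w ≠ x := by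
        rintro rfl
        rcases hw'.2.2 with h | h
        · exact hxy h.symm
        · exact hadj h
      have hwy : w ≠ y := by
        rintro rfl
        rcases hw.2.2 with h | h
        · exact hxy h
        · exact hadj h.symm
      exact ⟨w, ⟨⟨hwx, hwy, hxy⟩, Or.inl ⟨hw.2.2.resolve_left hwx.symm,
        hw'.2.2.resolve_left hwy.symm, hadj⟩⟩, hw.1, hw.2.1, hw'.2.1⟩
    · obtain ⟨w, hw⟩ := hx
      rw [hw.lab_eq, TimedOut.lab_eq hy] at hl
      subst hl
      exact absurd ⟨w, hw.1.hits⟩ hy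
    · obtain ⟨w, hw⟩ := hy
      rw [hw.lab_eq, TimedOut.lab_eq hx] at hl
      subst hl
      exact absurd ⟨x, hw.1.hits⟩ hx
    · rw [TimedOut.lab_eq hx, TimedOut.lab_eq hy] at hl
      exact absurd hl hxy

lemma TimedOut.lab_ne {x y : Fin n} (h : TimedOut G T σ x) (hxy : x ≠ y) :
    lab G T σ x ≠ lab G T σ y := by
  rw [h.lab_eq]
  intro e
  by_cases hy : ∃ w, Hits G T σ w y
  · obtain ⟨w, hw⟩ := hy
    rw [hw.lab_eq] at e
    subst e
    exact h ⟨x, hw.1.hits⟩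
  · rw [TimedOut.lab_eq hy] at e
    exact hxy e

/-! ### Counting -/

/-- The ordered pairs that are charged to a pivot. -/
def chargedPairs (G : SimpleGraph (Fin n)) (T : Fin n → ℕ) (σ : Equiv.Perm (Fin n)) :
    Finset (Fin n × Fin n) := univ.filter fun p => ∃ w, Charged G T σ w p.1 p.2

lemma two_mul_cost (s : Setoid (Fin n)) : 2 * cost G s =
    (univ.filter fun p : Fin n × Fin n =>
      p.1 ≠ p.2 ∧ ¬ (G.Adj p.1 p.2 ↔ s.r p.1 p.2)).card := by
  have h1 : (univ.filter fun p : Fin n × Fin n =>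
      p.1 ≠ p.2 ∧ ¬ (G.Adj p.1 p.2 ↔ s.r p.1 p.2)) =
      (univ.filter fun p : Fin n × Fin n => p.1 < p.2 ∧ ¬ (G.Adj p.1 p.2 ↔ s.r p.1 p.2)) ∪
      (univ.filter fun p : Fin n × Fin n =>
        p.2 < p.1 ∧ ¬ (G.Adj p.1 p.2 ↔ s.r p.1 p.2)) := by
    ext p
    simp only [mem_filter, mem_univ, true_and, mem_union, ← or_and_right]
    rw [ne_iff_lt_or_gt]
  have h2 : (univ.filter fun p : Fin n × Fin n =>
        p.2 < p.1 ∧ ¬ (G.Adj p.1 p.2 ↔ s.r p.1 p.2)).card = cost G s := by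
    refine card_bij (fun p _ => p.swap) ?_ ?_ ?_
    · rintro ⟨x, y⟩ h
      simp only [mem_filter, mem_univ, true_and, Prod.swap] at h ⊢
      rw [G.adj_comm, show s.r y x ↔ s.r x y from ⟨s.symm, s.symm⟩]
      exact h
    · intro p _ q _ h
      exact Prod.swap_injective h
    · rintro ⟨x, y⟩ h
      refine ⟨⟨y, x⟩, ?_, rfl⟩
      simp only [mem_filter, mem_univ, true_and] at h ⊢
      rw [G.adj_comm, show s.r y x ↔ s.r x y from ⟨s.symm, s.symm⟩]
      exact h
  rw [h1, card_union_of_disjoint, h2, two_mul]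
  · rfl
  · rw [disjoint_filter]
    rintro p _ ⟨h, _⟩ ⟨h', _⟩
    exact lt_asymm h h'

/-- If nodes that time out have few unclustered neighbours left, then nearly the whole cost is
charged to pivots. -/
lemma cost_lab_le (hT : ∀ v, 0 < T v) {δ : ℝ} (hδ : 0 ≤ δ)
    (hdeg : ∀ x, x ∈ alive G T σ (T x - 1) →
      ((univ.filter fun y => G.Adj x y ∧ y ∈ alive G T σ (T x - 1)).card : ℝ) ≤
        δ * G.degree x) :
    (1 - 2 * δ) * (2 * (cost G (Setoid.ker (lab G T σ)) : ℝ)) ≤ (chargedPairs G T σ).card := by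
  set D := univ.filter fun p : Fin n × Fin n =>
      p.1 ≠ p.2 ∧ ¬ (G.Adj p.1 p.2 ↔ (Setoid.ker (lab G T σ)).r p.1 p.2) with hD
  have hcost : (2 * (cost G (Setoid.ker (lab G T σ)) : ℝ)) = D.card := by
    exact_mod_cast two_mul_cost (G := G) (Setoid.ker (lab G T σ))
  set S := univ.filter fun x => TimedOut G T σ x with hS
  set X := S.sigma fun x => univ.filter fun y => G.Adj x y ∧ y ∈ alive G T σ (T x - 1) with hX
  have hDle : D.card ≤ (chargedPairs G T σ).card + 2 * X.card := by
    have hsub : D ⊆ chargedPairs G T σ ∪ (X.image (fun q => (q.1, q.2)) ∪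
        X.image (fun q => (q.2, q.1))) := by
      rintro ⟨x, y⟩ hp
      simp only [hD, mem_filter, mem_univ, true_and] at hp
      simp only [chargedPairs, mem_union, mem_filter, mem_univ, true_and, mem_image, hX, hS,
        mem_sigma, Sigma.exists, Prod.mk.injEq]
      rcases disagreement_cases hT hp.1 hp.2 with h | h | h
      · exact Or.inl h
      · exact Or.inr (Or.inl ⟨x, y, ⟨h.2.1, h.1, h.2.2⟩, rfl, rfl⟩)
      · exact Or.inr (Or.inr ⟨y, x, ⟨h.2.1, h.1, h.2.2⟩, rfl, rfl⟩)
    have h1 := card_le_card hsub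
    have h2 := card_union_le (chargedPairs G T σ) (X.image (fun q => (q.1, q.2)) ∪
        X.image (fun q => (q.2, q.1)))
    have h3 := card_union_le (X.image (fun q => (q.1, q.2))) (X.image (fun q => (q.2, q.1)))
    have h4 : (X.image (fun q => (q.1, q.2))).card ≤ X.card := card_image_le
    have h5 : (X.image (fun q => (q.2, q.1))).card ≤ X.card := card_image_le
    omega
  have hXle : (X.card : ℝ) ≤ δ * ∑ x ∈ S, (G.degree x : ℝ) := by
    rw [hX, card_sigma, Nat.cast_sum, mul_sum]
    refine sum_le_sum fun x hx => hdeg x ?_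
    simp only [hS, mem_filter, mem_univ, true_and] at hx
    have := hT x
    exact hx.mem_alive (by omega)
  -- A timed-out node is a singleton, so each of its edges is a disagreement. Thus the cost itself
  -- pays for the degrees, and the excess `2 * X.card` is absorbed into the left-hand side.
  have hSle : ∑ x ∈ S, (G.degree x : ℝ) ≤ D.card := by
    have : ∑ x ∈ S, G.degree x ≤ D.card := by
      calc ∑ x ∈ S, G.degree x = (S.sigma fun x => G.neighborFinset x).card := by
            rw [card_sigma]; rfl
        _ ≤ D.card := by
            refine card_le_card_of_injOn (fun q => (q.1, q.2)) ?_ ?_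
            · rintro ⟨x, y⟩ h
              simp only [coe_sigma, Set.mem_sigma_iff, mem_coe, SimpleGraph.mem_neighborFinset,
                hS, mem_filter, mem_univ, true_and] at h
              simp only [hD, coe_filter, Set.mem_ofPred_eq, mem_univ, true_and]
              exact ⟨h.2.ne, fun e => h.1.lab_ne h.2.ne (e.1 h.2)⟩
            · rintro ⟨x, y⟩ _ ⟨x', y'⟩ _ h
              simp only [Prod.mk.injEq] at h
              rw [h.1, h.2]
    exact_mod_cast this
  have hDle' : (D.card : ℝ) ≤ (chargedPairs G T σ).card + 2 * X.card := by exact_mod_cast hDle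
  have := mul_le_mul_of_nonneg_left hSle hδ
  rw [hcost]
  linarith

end Greedy

/-! ### Uniformly random orders: packing of bad triples, and late survivors -/

section RandomOrder

variable {n : ℕ} {G : SimpleGraph (Fin n)} {T : Fin n → ℕ}

lemma Charged.hits_or {σ : Equiv.Perm (Fin n)} {w x y : Fin n}
    (h : Charged G T σ w x y) : Hits G T σ w x ∨ Hits G T σ w y := by
  rcases h.1.2 with h' | h' | h'
  · exact Or.inl ⟨h.2.1, h.2.2.1, Or.inr h'.1⟩
  · exact Or.inl ⟨h.2.1, h.2.2.1, Or.inr h'.1⟩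
  · exact Or.inr ⟨h.2.1, h.2.2.2, Or.inr h'.2.1⟩

lemma Charged.unique {σ : Equiv.Perm (Fin n)} {w w' x y : Fin n}
    (h : Charged G T σ w x y) (h' : Charged G T σ w' x y) : w = w' := by
  have key : ∀ w w', Charged G T σ w x y → Charged G T σ w' x y → ¬ (σ w : ℕ) < σ w' := by
    intro w w' h h' hlt
    rcases h.hits_or with hh | hh
    · exact (mem_alive.1 h'.2.2.1).2 w h.2.1 hlt hh.2.2
    · exact (mem_alive.1 h'.2.2.2).2 w h.2.1 hlt hh.2.2
  have h1 := key w w' h h'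
  have h2 := key w' w h' h
  exact σ.injective (Fin.ext (by omega))

lemma Charged.pos_lt {σ : Equiv.Perm (Fin n)} {w x y : Fin n} (h : Charged G T σ w x y) :
    (σ w : ℕ) < σ x := by
  have := le_of_mem_alive h.2.2.1
  have hne : (σ w : ℕ) ≠ σ x := fun e => h.1.1.1 (σ.injective (Fin.ext e))
  omega

/-- Since x comes after w, exchanging the two leaves all positions before that of w untouched. The
unclustered set at that moment is unchanged, and x now becomes the pivot there. This bijection makes
the charging probability symmetric in the triple. -/
lemma Charged.swap {σ : Equiv.Perm (Fin n)} {w x y : Fin n} (h : Charged G T σ w x y) :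
    Charged G T (σ * Equiv.swap w x) x w y := by
  have hal : alive G T (σ * Equiv.swap w x) (σ w) = alive G T σ (σ w) := by
    refine alive_congr fun u hu => ?_
    have := h.pos_lt
    rw [Equiv.Perm.mul_apply] at hu ⊢
    by_cases hw : u = w
    · subst hw
      rw [Equiv.swap_apply_left] at hu
      omega
    by_cases hx : u = x
    · subst hx
      rw [Equiv.swap_apply_right] at hu
      omega
    rw [Equiv.swap_apply_of_ne_of_ne hw hx]
  have hpos : (σ * Equiv.swap w x) x = σ w := by
    rw [Equiv.Perm.mul_apply, Equiv.swap_apply_right]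
  refine ⟨h.1.symm_left, ?_, ?_, ?_⟩
  · rw [IsPivot, hpos, hal]
    exact h.2.2.1
  · rw [hpos, hal]
    exact h.2.1
  · rw [hpos, hal]
    exact h.2.2.2

/-- The number of orders for which the triple is charged to its first node. -/
def chargeCount (G : SimpleGraph (Fin n)) (T : Fin n → ℕ) (w x y : Fin n) : ℕ :=
  (univ.filter fun σ => Charged G T σ w x y).card

lemma chargeCount_symm (w x y : Fin n) : chargeCount G T w x y = chargeCount G T w y x := by
  unfold chargeCount
  congr 1
  exact filter_congr fun σ _ => ⟨Charged.symm, Charged.symm⟩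

lemma chargeCount_swap (w x y : Fin n) : chargeCount G T w x y = chargeCount G T x w y := by
  unfold chargeCount
  refine card_bij' (fun σ _ => σ * Equiv.swap w x) (fun σ _ => σ * Equiv.swap x w) ?_ ?_ ?_ ?_
  · intro σ h
    simp only [mem_filter, mem_univ, true_and] at h ⊢
    exact h.swap
  · intro σ h
    simp only [mem_filter, mem_univ, true_and] at h ⊢
    exact h.swap
  · intro σ _
    rw [Equiv.swap_comm x w, mul_assoc, Equiv.swap_mul_self, mul_one]
  · intro σ _
    rw [Equiv.swap_comm x w, mul_assoc, Equiv.swap_mul_self, mul_one]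

lemma card_perm_apply_eq (x i : Fin n) :
    n * (univ.filter fun σ : Equiv.Perm (Fin n) => σ x = i).card = n.factorial := by
  have h : ∀ j : Fin n, (univ.filter fun σ : Equiv.Perm (Fin n) => σ x = j).card =
      (univ.filter fun σ : Equiv.Perm (Fin n) => σ x = i).card := by
    intro j
    refine card_bij' (fun σ _ => Equiv.swap i j * σ) (fun σ _ => Equiv.swap i j * σ) ?_ ?_ ?_ ?_
    · intro σ h
      simp only [mem_filter, mem_univ, true_and] at h ⊢
      rw [Equiv.Perm.mul_apply, h, Equiv.swap_apply_right]
    · intro σ h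
      simp only [mem_filter, mem_univ, true_and] at h ⊢
      rw [Equiv.Perm.mul_apply, h, Equiv.swap_apply_left]
    · intro σ _
      rw [← mul_assoc, Equiv.swap_mul_self, one_mul]
    · intro σ _
      rw [← mul_assoc, Equiv.swap_mul_self, one_mul]
  have h2 := card_eq_sum_card_fiberwise (s := (univ : Finset (Equiv.Perm (Fin n))))
    (t := univ) (f := fun σ => σ x) (fun _ _ => mem_univ _)
  rw [sum_congr rfl fun j _ => h j, sum_const, card_univ, card_univ, Fintype.card_perm,
    Fintype.card_fin, smul_eq_mul] at h2
  exact h2.symm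

/-- A pair is not charged if one of its nodes comes first. -/
lemma sum_chargeCount_le {x y : Fin n} (hxy : x ≠ y) :
    n * ∑ w, chargeCount G T w x y + 2 * n.factorial ≤ n * n.factorial := by
  have hn : 0 < n := x.pos
  let i : Fin n := ⟨0, hn⟩
  let F : Fin n → Finset (Equiv.Perm (Fin n)) := fun x => univ.filter fun σ => σ x = i
  let C : Finset (Equiv.Perm (Fin n)) := univ.filter fun σ => ∃ w, Charged G T σ w x y
  have h1 : ∑ w, chargeCount G T w x y ≤ C.card := by
    unfold chargeCount
    rw [← card_biUnion]
    · refine card_le_card fun σ h => ?_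
      simp only [mem_biUnion, mem_filter, mem_univ, true_and] at h
      simpa [C] using h
    · intro w _ w' _ hne
      refine disjoint_filter.2 fun σ _ h h' => hne (h.unique h')
  have hd1 : Disjoint (F x) (F y) := by
    rw [disjoint_filter]
    intro σ _ h h'
    exact hxy (σ.injective (h.trans h'.symm))
  have hd2 : Disjoint C (F x ∪ F y) := by
    rw [disjoint_left]
    intro σ h h'
    simp only [C, F, mem_union, mem_filter, mem_univ, true_and] at h h'
    obtain ⟨w, hw⟩ := h
    have h1 := hw.pos_lt
    have h2 := hw.symm.pos_lt
    rcases h' with h' | h'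
    · rw [h'] at h1
      exact absurd h1 (Nat.not_lt_zero _)
    · rw [h'] at h2
      exact absurd h2 (Nat.not_lt_zero _)
  have h2 := card_le_univ (C ∪ (F x ∪ F y))
  rw [card_union_of_disjoint hd2, card_union_of_disjoint hd1, Fintype.card_perm,
    Fintype.card_fin] at h2
  have h3 := Nat.mul_le_mul_left n h2
  rw [mul_add, mul_add, card_perm_apply_eq, card_perm_apply_eq] at h3
  have h4 := Nat.mul_le_mul_left n h1
  omega

lemma exists_cost_eq_opt (G : SimpleGraph (Fin n)) : ∃ s, cost G s = opt G :=
  Nat.sInf_mem (Set.range_nonempty fun s => cost G s)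

/-- The expected number of charged pairs is at most `6 (1 - 2 / n)` times the optimum. -/
lemma sum_card_chargedPairs_le :
    n * ∑ σ, (chargedPairs G T σ).card ≤ 6 * (n - 2) * n.factorial * opt G := by
  obtain ⟨s, hs⟩ := exists_cost_eq_opt G
  let d : Fin n → Fin n → ℕ := fun x y => if x ≠ y ∧ ¬ (G.Adj x y ↔ s.r x y) then 1 else 0
  let q := chargeCount G T
  have hd : ∑ x, ∑ y, d x y = 2 * opt G := by
    rw [← hs, two_mul_cost, card_filter, Fintype.sum_prod_type]
  have hZ : ∑ σ, (chargedPairs G T σ).card ≤ ∑ w, ∑ x, ∑ y, q w x y := by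
    calc ∑ σ, (chargedPairs G T σ).card
        ≤ ∑ σ : Equiv.Perm (Fin n), ∑ w, ∑ x, ∑ y, if Charged G T σ w x y then 1 else 0 := by
          refine sum_le_sum fun σ _ => ?_
          have hsub : chargedPairs G T σ ⊆
              univ.biUnion fun w => univ.filter fun p : Fin n × Fin n =>
                Charged G T σ w p.1 p.2 := by
            intro p hp
            simpa [chargedPairs] using hp
          refine (card_le_card hsub).trans (card_biUnion_le.trans (le_of_eq ?_))
          refine sum_congr rfl fun w _ => ?_
          rw [card_filter, Fintype.sum_prod_type]
      _ = ∑ w, ∑ x, ∑ y, q w x y := by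
          rw [sum_comm]
          refine sum_congr rfl fun w _ => ?_
          rw [sum_comm]
          refine sum_congr rfl fun x _ => ?_
          rw [sum_comm]
          refine sum_congr rfl fun y _ => ?_
          simp only [q, chargeCount, card_filter]
  have hq0 : ∀ w x y, ¬ BadTriple G w x y → q w x y = 0 := by
    intro w x y h
    simp only [q, chargeCount, card_eq_zero]
    exact filter_eq_empty_iff.2 fun σ _ hc => h hc.1
  -- By transitivity, every clustering, in particular the optimal `s`, disagrees with at least one
  -- of the three pairs of a bad triple.
  have hcov : ∀ w x y, q w x y ≤ q w x y * d x y + q w x y * d w x + q w x y * d w y := by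
    intro w x y
    by_cases hb : BadTriple G w x y
    · have : 1 ≤ d x y + d w x + d w y := by
        by_contra! hlt
        have hd0 : ∀ x y, d x y < 1 → x ≠ y → (G.Adj x y ↔ s.r x y) := by
          intro x y h hne
          by_contra hc
          simp [d, hne, hc] at h
        have e1 := hd0 x y (by omega) hb.1.2.2
        have e2 := hd0 w x (by omega) hb.1.1
        have e3 := hd0 w y (by omega) hb.1.2.1
        have t1 : s.r w x → s.r w y → s.r x y := fun a b => s.trans (s.symm a) b
        have t2 : s.r w x → s.r x y → s.r w y := fun a b => s.trans a b
        have t3 : s.r w y → s.r x y → s.r w x := fun a b => s.trans a (s.symm b)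
        rcases hb.2 with h | h | h <;> tauto
      calc q w x y = q w x y * 1 := (mul_one _).symm
        _ ≤ q w x y * (d x y + d w x + d w y) := Nat.mul_le_mul_left _ this
        _ = _ := by ring
    · simp [hq0 w x y hb]
  -- As `q` is symmetric, the three pairs of a triple contribute equal totals. This is the source of
  -- the factor 3; the remaining factor 2 counts ordered pairs.
  have e1 : ∑ w, ∑ x, ∑ y, q w x y * d w x = ∑ w, ∑ x, ∑ y, q w x y * d x y := by
    calc ∑ w, ∑ x, ∑ y, q w x y * d w x = ∑ w, ∑ x, ∑ y, q y w x * d w x := by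
          refine sum_congr rfl fun w _ => sum_congr rfl fun x _ => sum_congr rfl fun y _ => ?_
          rw [show q w x y = q y w x by
            simp only [q]; rw [chargeCount_symm, chargeCount_swap]]
      _ = ∑ w, ∑ y, ∑ x, q y w x * d w x := sum_congr rfl fun w _ => sum_comm
      _ = _ := sum_comm
  have e2 : ∑ w, ∑ x, ∑ y, q w x y * d w y = ∑ w, ∑ x, ∑ y, q w x y * d x y := by
    calc ∑ w, ∑ x, ∑ y, q w x y * d w y = ∑ w, ∑ x, ∑ y, q x w y * d w y := by
          refine sum_congr rfl fun w _ => sum_congr rfl fun x _ => sum_congr rfl fun y _ => ?_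
          rw [show q w x y = q x w y from chargeCount_swap w x y]
      _ = _ := sum_comm
  have htot : ∑ w, ∑ x, ∑ y, q w x y ≤ 3 * ∑ w, ∑ x, ∑ y, q w x y * d x y := by
    calc ∑ w, ∑ x, ∑ y, q w x y
        ≤ ∑ w, ∑ x, ∑ y, (q w x y * d x y + q w x y * d w x + q w x y * d w y) :=
          sum_le_sum fun w _ => sum_le_sum fun x _ => sum_le_sum fun y _ => hcov w x y
      _ = 3 * ∑ w, ∑ x, ∑ y, q w x y * d x y := by
          simp only [sum_add_distrib]
          rw [e1, e2]
          ring
  have hre : ∑ w, ∑ x, ∑ y, q w x y * d x y = ∑ x, ∑ y, d x y * ∑ w, q w x y := by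
    rw [sum_comm]
    refine sum_congr rfl fun x _ => ?_
    rw [sum_comm]
    refine sum_congr rfl fun y _ => ?_
    rw [mul_sum]
    exact sum_congr rfl fun w _ => mul_comm _ _
  have hpack : n * ∑ x, ∑ y, d x y * ∑ w, q w x y ≤ 2 * opt G * ((n - 2) * n.factorial) := by
    rw [← hd, sum_mul, mul_sum]
    refine sum_le_sum fun x _ => ?_
    rw [sum_mul, mul_sum]
    refine sum_le_sum fun y _ => ?_
    by_cases hxy : x = y
    · simp [d, hxy]
    · have := sum_chargeCount_le (G := G) (T := T) hxy
      rw [mul_left_comm]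
      refine Nat.mul_le_mul_left _ ?_
      rw [Nat.sub_mul]
      simp only [q]
      omega
  calc n * ∑ σ, (chargedPairs G T σ).card
      ≤ n * (3 * ∑ w, ∑ x, ∑ y, q w x y * d x y) := Nat.mul_le_mul_left _ (hZ.trans htot)
    _ = 3 * (n * ∑ x, ∑ y, d x y * ∑ w, q w x y) := by rw [hre]; ring
    _ ≤ 3 * (2 * opt G * ((n - 2) * n.factorial)) := Nat.mul_le_mul_left _ hpack
    _ = _ := by ring

/-- The unclustered neighbours of `x` at time `t`. -/
def aliveNbrs (G : SimpleGraph (Fin n)) (T : Fin n → ℕ) (σ : Equiv.Perm (Fin n)) (x : Fin n)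
    (t : ℕ) : Finset (Fin n) := univ.filter fun y => G.Adj x y ∧ y ∈ alive G T σ t

/-- The orders for which `x` and at least `β` of its neighbours are unclustered at time `t`. -/
def lateOrders (G : SimpleGraph (Fin n)) (T : Fin n → ℕ) (x : Fin n) (β : ℝ) (t : ℕ) :
    Finset (Equiv.Perm (Fin n)) :=
  univ.filter fun σ => x ∈ alive G T σ t ∧ β ≤ (aliveNbrs G T σ x t).card

lemma alive_swap_mul (σ : Equiv.Perm (Fin n)) {i j : Fin n} (hij : i ≤ j) :
    alive G T (Equiv.swap i j * σ) i = alive G T σ i := by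
  refine alive_congr fun w hw => ?_
  rw [Equiv.Perm.mul_apply] at hw ⊢
  have hij' : (i : ℕ) ≤ j := hij
  by_cases h1 : σ w = i
  · rw [h1, Equiv.swap_apply_left] at hw
    omega
  by_cases h2 : σ w = j
  · rw [h2, Equiv.swap_apply_right] at hw
    omega
  exact Equiv.swap_apply_of_ne_of_ne h1 h2

/-- Given the nodes before position i, the remaining ones are equally likely to come at position i.
If one of the at least β unclustered neighbours of x does, it becomes a pivot and x leaves.
Conditioning is replaced by swaps of the positions i and j ≥ i, which do not affect the unclustered
set at time i and map `H j` into `H i`. -/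
lemma card_lateOrders_succ_le (x : Fin n) {β : ℝ} (i : Fin n) :
    ((lateOrders G T x β (i + 1)).card : ℝ) ≤
      (1 - β / n) * (lateOrders G T x β i).card := by
  let E := lateOrders G T x β i
  let H : Fin n → Finset (Equiv.Perm (Fin n)) := fun j =>
    E.filter fun σ => σ.symm j ∈ aliveNbrs G T σ x i
  have hn : (0 : ℝ) < n := by exact_mod_cast i.pos
  have hH : ∀ j, (H j).card ≤ (H i).card := by
    intro j
    rcases lt_or_ge j i with hlt | hge
    · have : H j = ∅ := by
        refine filter_eq_empty_iff.2 fun σ _ h => ?_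
        simp only [aliveNbrs, mem_filter, mem_univ, true_and] at h
        have := le_of_mem_alive h.2
        rw [Equiv.apply_symm_apply] at this
        exact absurd hlt (not_lt.2 this)
      rw [this, card_empty]
      exact Nat.zero_le _
    · refine card_le_card_of_injOn (fun σ => Equiv.swap i j * σ) ?_
        fun σ _ σ' _ h => mul_left_cancel h
      intro σ h
      replace h := mem_coe.1 h
      refine mem_coe.2 ?_
      obtain ⟨h1, h2⟩ := mem_filter.1 h
      replace h1 := (mem_filter.1 h1).2
      have hN : aliveNbrs G T (Equiv.swap i j * σ) x i = aliveNbrs G T σ x i := by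
        rw [aliveNbrs, alive_swap_mul σ hge, aliveNbrs]
      refine mem_filter.2 ⟨mem_filter.2 ⟨mem_univ _, ?_⟩, ?_⟩
      · rw [alive_swap_mul σ hge, hN]
        exact h1
      have : (Equiv.swap i j * σ).symm i = σ.symm j := by
        rw [Equiv.symm_apply_eq, Equiv.Perm.mul_apply, Equiv.apply_symm_apply,
          Equiv.swap_apply_right]
      rw [this, hN]
      exact h2
  have hsum : β * E.card ≤ n * (H i).card := by
    have h1 : ∑ j, (H j).card = ∑ σ ∈ E, (aliveNbrs G T σ x i).card := by
      simp only [H, card_filter]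
      rw [sum_comm]
      refine sum_congr rfl fun σ _ => ?_
      rw [← Equiv.sum_comp σ]
      simp only [Equiv.symm_apply_apply]
      rw [← card_filter]
      congr 1
      ext y
      simp
    have h2 : ∑ j, (H j).card ≤ n * (H i).card := by
      calc ∑ j, (H j).card ≤ ∑ _j : Fin n, (H i).card := sum_le_sum fun j _ => hH j
        _ = n * (H i).card := by simp
    calc β * E.card = ∑ σ ∈ E, β := by rw [sum_const, nsmul_eq_mul, mul_comm]
      _ ≤ ∑ σ ∈ E, ((aliveNbrs G T σ x i).card : ℝ) := by
          refine sum_le_sum fun σ h => ?_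
          simp only [E, lateOrders, mem_filter, mem_univ, true_and] at h
          exact h.2
      _ = ((∑ j, (H j).card : ℕ) : ℝ) := by rw [h1]; push_cast; rfl
      _ ≤ n * (H i).card := by exact_mod_cast h2
  have hsub : lateOrders G T x β (i + 1) ⊆ E \ H i := by
    intro σ h
    simp only [E, H, lateOrders, mem_sdiff, mem_filter, mem_univ, true_and] at h ⊢
    have hmono : aliveNbrs G T σ x (i + 1) ⊆ aliveNbrs G T σ x i := by
      intro y hy
      simp only [aliveNbrs, mem_filter, mem_univ, true_and] at hy ⊢
      exact ⟨hy.1, alive_anti (Nat.le_succ _) hy.2⟩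
    have hc : ((aliveNbrs G T σ x (i + 1)).card : ℝ) ≤ (aliveNbrs G T σ x i).card := by
      exact_mod_cast card_le_card hmono
    refine ⟨⟨alive_anti (Nat.le_succ _) h.1, h.2.trans hc⟩, fun hh => ?_⟩
    have hw := hh.2
    simp only [aliveNbrs, mem_filter, mem_univ, true_and] at hw
    refine (mem_alive.1 h.1).2 (σ.symm i) ?_ ?_ (Or.inr hw.1.symm)
    · rw [IsPivot, Equiv.apply_symm_apply]
      exact hw.2
    · rw [Equiv.apply_symm_apply]
      exact Nat.lt_succ_self _
  have hcard : (lateOrders G T x β (i + 1)).card + (H i).card ≤ E.card := by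
    have h1 := card_le_card hsub
    have h2 : (E \ H i).card + (H i).card = E.card :=
      card_sdiff_add_card_eq_card (filter_subset _ _)
    omega
  have hcard' : ((lateOrders G T x β (i + 1)).card : ℝ) + (H i).card ≤ E.card := by
    exact_mod_cast hcard
  have hdiv : β / n * E.card ≤ (H i).card := by
    rw [div_mul_eq_mul_div, div_le_iff₀ hn]
    linarith
  have : (1 - β / n) * (E.card : ℝ) = E.card - β / n * E.card := by ring
  change _ ≤ (1 - β / n) * (E.card : ℝ)
  linarith

/-- A node rarely stays unclustered together with many neighbours. -/
lemma card_lateOrders_le (x : Fin n) (β : ℝ) {t : ℕ} (ht : t ≤ n) :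
    ((lateOrders G T x β t).card : ℝ) ≤ Real.exp (-(β * t / n)) * n.factorial := by
  induction t with
  | zero =>
    have := card_le_univ (lateOrders G T x β 0)
    rw [Fintype.card_perm, Fintype.card_fin] at this
    simpa using this
  | succ t ih =>
    have h1 := card_lateOrders_succ_le (G := G) (T := T) x (β := β) ⟨t, ht⟩
    have h2 : 1 - β / n ≤ Real.exp (-(β / n)) := by
      have := Real.add_one_le_exp (-(β / n))
      linarith
    calc ((lateOrders G T x β (t + 1)).card : ℝ)
        ≤ (1 - β / n) * (lateOrders G T x β t).card := h1
      _ ≤ Real.exp (-(β / n)) * (lateOrders G T x β t).card :=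
          mul_le_mul_of_nonneg_right h2 (Nat.cast_nonneg _)
      _ ≤ Real.exp (-(β / n)) * (Real.exp (-(β * t / n)) * n.factorial) :=
          mul_le_mul_of_nonneg_left (ih (by omega)) (Real.exp_nonneg _)
      _ = Real.exp (-(β * (t + 1 : ℕ) / n)) * n.factorial := by
          rw [← mul_assoc, ← Real.exp_add]
          congr 2
          push_cast
          ring

end RandomOrder

/-! ### Arithmetic of degree classes -/

section DegreeClasses

variable {P : Params} {n : ℕ}

lemma theta_eq (P : Params) (n j : ℕ) : P.theta n j = 2 ^ j * P.theta0 n := by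
  induction j with
  | zero => simp [Params.theta]
  | succ j ih => rw [Params.theta, ih, pow_succ]; ring

lemma degClass_le_iff (h0 : 1 ≤ P.theta0 n) {d j : ℕ} :
    P.degClass n d ≤ j ↔ d ≤ P.theta n j := by
  constructor
  · intro h
    have hne : {j | d ≤ P.theta n j}.Nonempty := by
      refine ⟨d, ?_⟩
      change d ≤ P.theta n d
      rw [theta_eq]
      exact d.lt_two_pow_self.le.trans (Nat.le_mul_of_pos_right _ h0)
    have h1 : d ≤ P.theta n (P.degClass n d) := Nat.sInf_mem hne
    rw [theta_eq] at h1 ⊢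
    exact h1.trans (Nat.mul_le_mul_right _ (Nat.pow_le_pow_right two_pos h))
  · exact fun h => Nat.sInf_le h

lemma degClass_zero : P.degClass n 0 = 0 :=
  Nat.le_zero.1 (Nat.sInf_le (Nat.zero_le _))

lemma degClass_mono (h0 : 1 ≤ P.theta0 n) {d d' : ℕ} (h : d ≤ d') :
    P.degClass n d ≤ P.degClass n d' :=
  (degClass_le_iff h0).2 (h.trans ((degClass_le_iff h0).1 le_rfl))

lemma degClass_succ_le (h0 : 1 ≤ P.theta0 n) (d : ℕ) :
    P.degClass n (d + 1) ≤ P.degClass n d + 1 := by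
  rw [degClass_le_iff h0]
  have h1 : d ≤ P.theta n (P.degClass n d) := (degClass_le_iff h0).1 le_rfl
  have h2 : 1 ≤ P.theta n (P.degClass n d) := by
    rw [theta_eq]
    exact Nat.mul_pos (by positivity) h0
  rw [Params.theta]
  omega

lemma degClass_succ (h0 : 1 ≤ P.theta0 n) {d : ℕ}
    (h : P.degClass n (d + 1) ≠ P.degClass n d) :
    P.degClass n (d + 1) = P.degClass n d + 1 := by
  have := degClass_succ_le h0 d
  have : P.degClass n d ≤ P.degClass n (d + 1) := degClass_mono h0 (by omega)
  omega

lemma lt_of_degClass_eq_succ (h0 : 1 ≤ P.theta0 n) {d j : ℕ} (h : P.degClass n d = j + 1) :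
    2 ^ j * P.theta0 n < d := by
  rw [← theta_eq]
  by_contra! hle
  have := (degClass_le_iff h0).2 hle
  omega

/-- Class j + 1 requires a degree above 2^j θ_0, so 2^j < n. Hence no node exhausts its coins, and
the default value in `coin` does not matter. -/
lemma degClass_le_len (h0 : 1 ≤ P.theta0 n) (ha : 1 ≤ P.a) {d : ℕ} (hd : d < n) :
    P.degClass n d ≤ P.len n := by
  rcases hj : P.degClass n d with _ | j
  · exact Nat.zero_le _
  · have h1 := lt_of_degClass_eq_succ h0 hj
    have h2 : 2 ^ j < n := (Nat.le_mul_of_pos_right _ h0).trans_lt (h1.trans hd)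
    have hn : (0 : ℝ) < n := by exact_mod_cast (Nat.zero_le d).trans_lt hd
    have h3 : (j : ℝ) < Real.logb 2 n := by
      rw [Real.lt_logb_iff_rpow_lt one_lt_two hn, Real.rpow_natCast]
      exact_mod_cast h2
    refine Nat.succ_le_of_lt (Nat.lt_ceil.2 (h3.trans_le ?_))
    have hL : 0 ≤ Real.logb 2 n := (Nat.cast_nonneg j).trans h3.le
    exact le_mul_of_one_le_left hL (by exact_mod_cast ha)

end DegreeClasses

/-! ### The state as a function of the revealed edges and the coins -/

section Stream

variable {P : Params} {n : ℕ} {G : SimpleGraph (Fin n)}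

/-- The first `k` bits of the rank of `u` are zero. -/
def PrefixZero (ω : Tape P n) (u : Fin n) (k : ℕ) : Prop :=
  ∀ i : Fin (P.len n), (i : ℕ) < k → ω u i = false

/-- The number of edges of the list that are incident to `u`. -/
def listDegree (R : List (Sym2 (Fin n))) (u : Fin n) : ℕ := (R.filter fun e => u ∈ e).length

/-- The memory after the edges in `R` were revealed, in any order. -/
def memAfter (ω : Tape P n) (R : List (Sym2 (Fin n))) : Memory n := fun u =>
  { deg := listDegree R u
    rank := (List.ofFn (ω u)).take (P.degClass n (listDegree R u))
    interesting := decide (PrefixZero ω u (P.degClass n (listDegree R u)))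
    nbrs := if PrefixZero ω u (P.degClass n (listDegree R u)) then
      univ.filter fun v => s(u, v) ∈ R else ∅
    pos := 0
    pivot := false
    label := u }

lemma prefixZero_succ {ω : Tape P n} {u : Fin n} {k : ℕ} (hk : k < P.len n) :
    PrefixZero ω u (k + 1) ↔ PrefixZero ω u k ∧ ω u ⟨k, hk⟩ = false := by
  constructor
  · exact fun h => ⟨fun i hi => h i (by omega), h _ (Nat.lt_succ_self k)⟩
  · rintro ⟨h1, h2⟩ i hi
    rcases Nat.lt_succ_iff_lt_or_eq.1 hi with h | h
    · exact h1 i h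
    · rwa [show i = ⟨k, hk⟩ from Fin.ext h]

lemma memAfter_nil (ω : Tape P n) : memAfter ω [] = initMem n := by
  funext u
  simp [memAfter, initMem, listDegree, degClass_zero, PrefixZero]

/-- One more edge raises the class by at most one, so the number of coins flipped by a node always
equals its class. The next coin is therefore the tape bit indexed by the current class. -/
lemma step_memAfter (h0 : 1 ≤ P.theta0 n) {ω : Tape P n} {R : List (Sym2 (Fin n))}
    {e : Sym2 (Fin n)} (hlen : ∀ u, P.degClass n (listDegree (e :: R) u) ≤ P.len n) :
    step ω e (memAfter ω R) = memAfter ω (e :: R) := by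
  funext u
  by_cases hu : u ∈ e
  · have hd : listDegree (e :: R) u = listDegree R u + 1 := by
      simp [listDegree, hu]
    have hl := hlen u
    rw [hd] at hl
    have hn : (univ.filter fun v => s(u, v) ∈ R) ∪ (univ.filter fun v => e = s(u, v)) =
        univ.filter fun v => s(u, v) ∈ e :: R := by
      ext v
      simp only [mem_union, mem_filter, mem_univ, true_and, List.mem_cons, eq_comm (a := e)]
      exact or_comm
    by_cases hs : P.degClass n (listDegree R u + 1) = P.degClass n (listDegree R u)
    · rw [step, if_pos hu]
      simp only [memAfter, NodeMem.receive, hd, hs, ne_eq, not_true_eq_false, decide_false,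
        Bool.false_and, Bool.not_false, Bool.and_true, Bool.false_eq_true, if_false,
        decide_eq_true_eq]
      congr 1
      split_ifs
      · exact hn
      · rfl
    · have hs' := degClass_succ h0 hs
      have hk : P.degClass n (listDegree R u) < P.len n := by omega
      have hc : coin ω u ((List.ofFn (ω u)).take (P.degClass n (listDegree R u))).length =
          ω u ⟨_, hk⟩ := by
        rw [List.length_take, List.length_ofFn, min_eq_left hk.le, coin, dif_pos hk]
      rw [step, if_pos hu]
      simp only [memAfter, NodeMem.receive, hd, hc]
      simp only [hs', ne_eq, Nat.succ_ne_self, not_false_eq_true, decide_true,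
        Bool.true_and, if_true, prefixZero_succ hk, Bool.and_eq_true, decide_eq_true_eq,
        Bool.not_eq_true']
      congr 1
      · rw [List.take_add_one, List.getElem?_ofFn, dif_pos hk, Option.toList_some]
      · rw [Bool.decide_and]
        congr 1
        cases ω u ⟨_, hk⟩ <;> rfl
      · split_ifs <;> first | exact hn | rfl | tauto
  · have hd : listDegree (e :: R) u = listDegree R u := by
      simp [listDegree, hu]
    have hn : ∀ v, s(u, v) ∈ e :: R ↔ s(u, v) ∈ R := by
      intro v
      rw [List.mem_cons, or_iff_right]
      rintro rfl
      exact hu (Sym2.mem_mk_left u v)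
    rw [step, if_neg hu]
    simp only [memAfter, hd, hn]

lemma listDegree_le_degree {R : List (Sym2 (Fin n))} (hR : R.Nodup)
    (hG : ∀ e ∈ R, e ∈ G.edgeSet) (u : Fin n) : listDegree R u ≤ G.degree u := by
  rw [listDegree, ← List.toFinset_card_of_nodup (hR.filter _),
    ← SimpleGraph.card_incidenceFinset_eq_degree]
  refine card_le_card fun e he => ?_
  simp only [List.mem_toFinset, List.mem_filter, decide_eq_true_eq] at he
  rw [SimpleGraph.mem_incidenceFinset]
  exact ⟨hG e he.1, he.2⟩

lemma listDegree_eq_degree {R : List (Sym2 (Fin n))} (hR : R.Nodup)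
    (hG : ∀ e, e ∈ R ↔ e ∈ G.edgeSet) (u : Fin n) : listDegree R u = G.degree u := by
  rw [listDegree, ← List.toFinset_card_of_nodup (hR.filter _),
    ← SimpleGraph.card_incidenceFinset_eq_degree]
  congr 1
  ext e
  simp only [List.mem_toFinset, List.mem_filter, decide_eq_true_eq,
    SimpleGraph.mem_incidenceFinset, hG]
  rfl

lemma degree_lt (G : SimpleGraph (Fin n)) (u : Fin n) : G.degree u < n := by
  have := G.degree_lt_card_verts u
  rwa [Fintype.card_fin] at this

/-- After `t` edges, the memory is determined by the list of the revealed edges. -/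
structure StreamSpec (adv : Adversary G) (ω : Tape P n) (t : ℕ) : Prop where
  nodup : (stream adv ω t).1.revealed.Nodup
  mem_edgeSet : ∀ e ∈ (stream adv ω t).1.revealed, e ∈ G.edgeSet
  length : (stream adv ω t).1.revealed.length = t
  mem_eq : (stream adv ω t).2 = memAfter ω (stream adv ω t).1.revealed

lemma streamSpec (h0 : 1 ≤ P.theta0 n) (ha : 1 ≤ P.a) (adv : Adversary G) (ω : Tape P n)
    {t : ℕ} (ht : t ≤ G.edgeFinset.card) : StreamSpec adv ω t := by
  induction t with
  | zero =>
    refine ⟨List.nodup_nil, fun e he => absurd he List.not_mem_nil, rfl, ?_⟩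
    exact (memAfter_nil ω).symm
  | succ t ih =>
    have ih := ih (by omega)
    have hex : ∃ e ∈ G.edgeSet, e ∉ (stream adv ω t).1.revealed := by
      by_contra! hall
      have hsub : G.edgeFinset ⊆ (stream adv ω t).1.revealed.toFinset := by
        intro e he
        rw [List.mem_toFinset]
        exact hall e (SimpleGraph.mem_edgeFinset.1 he)
      have := card_le_card hsub
      have := List.toFinset_card_le (stream adv ω t).1.revealed
      rw [ih.length] at this
      omega
    obtain ⟨h1, h2⟩ := adv.next_spec _ hex
    have hR : (stream adv ω (t + 1)).1.revealed =
        adv.next (stream adv ω t).1 :: (stream adv ω t).1.revealed := rfl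
    have hm : (stream adv ω (t + 1)).2 =
        step ω (adv.next (stream adv ω t).1) (stream adv ω t).2 := rfl
    have hnd : (stream adv ω (t + 1)).1.revealed.Nodup := by
      rw [hR]
      exact List.nodup_cons.2 ⟨h2, ih.nodup⟩
    have hG : ∀ e ∈ (stream adv ω (t + 1)).1.revealed, e ∈ G.edgeSet := by
      rw [hR]
      intro e he
      rcases List.mem_cons.1 he with rfl | he
      · exact h1
      · exact ih.mem_edgeSet e he
    refine ⟨hnd, hG, by rw [hR, List.length_cons, ih.length], ?_⟩
    rw [hm, ih.mem_eq, hR]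
    refine step_memAfter h0 fun u => degClass_le_len h0 ha ?_
    rw [← hR]
    exact (listDegree_le_degree hnd hG u).trans_lt (degree_lt G u)

lemma mem_revealed_iff {adv : Adversary G} {ω : Tape P n}
    (h : StreamSpec adv ω G.edgeFinset.card) (e : Sym2 (Fin n)) :
    e ∈ (stream adv ω G.edgeFinset.card).1.revealed ↔ e ∈ G.edgeSet := by
  have hsub : (stream adv ω G.edgeFinset.card).1.revealed.toFinset ⊆ G.edgeFinset := by
    intro e he
    rw [List.mem_toFinset] at he
    exact SimpleGraph.mem_edgeFinset.2 (h.mem_edgeSet e he)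
  have heq := eq_of_subset_of_card_le hsub (by
    rw [List.toFinset_card_of_nodup h.nodup, h.length])
  have := Finset.ext_iff.1 heq e
  rwa [List.mem_toFinset, SimpleGraph.mem_edgeFinset] at this

/-- After the stream, the memory does not depend on the order of the edges. -/
lemma endOfStream_eq (h0 : 1 ≤ P.theta0 n) (ha : 1 ≤ P.a) (adv : Adversary G) (ω : Tape P n)
    (u : Fin n) : endOfStream adv ω u =
      { deg := G.degree u
        rank := (List.ofFn (ω u)).take (P.degClass n (G.degree u))
        interesting := decide (PrefixZero ω u (P.degClass n (G.degree u)))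
        nbrs := if PrefixZero ω u (P.degClass n (G.degree u)) then
          univ.filter fun v => G.Adj u v else ∅
        pos := 0
        pivot := false
        label := u } := by
  have h := streamSpec h0 ha adv ω le_rfl
  rw [endOfStream, h.mem_eq]
  have hd := listDegree_eq_degree h.nodup (mem_revealed_iff h) u
  simp only [memAfter, hd, mem_revealed_iff h, SimpleGraph.mem_edgeSet]

/-- A coin has an effect only if the class switches. It is then appended to the rank, so its index
lies below the new rank length. -/
lemma step_congr {ω ω' : Tape P n} {e : Sym2 (Fin n)} {m : Memory n}
    (h : ∀ u (i : Fin (P.len n)), (i : ℕ) < (step ω e m u).rank.length → ω u i = ω' u i) :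
    step ω e m = step ω' e m := by
  funext u
  have hu := h u
  by_cases hue : u ∈ e
  · rw [step, if_pos hue] at hu
    rw [step, step, if_pos hue, if_pos hue]
    by_cases hs : P.degClass n ((m u).deg + 1) = P.degClass n (m u).deg
    · simp [NodeMem.receive, hs]
    · have hc : coin ω u (m u).rank.length = coin ω' u (m u).rank.length := by
        unfold coin
        split_ifs with hl
        · refine hu _ ?_
          simp [NodeMem.receive, hs]
        · rfl
      rw [hc]
  · rw [step, step, if_neg hue, if_neg hue]

lemma rank_length_le_step (ω : Tape P n) (e : Sym2 (Fin n)) (m : Memory n) (u : Fin n) :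
    (m u).rank.length ≤ (step ω e m u).rank.length := by
  unfold step
  split_ifs
  · simp only [NodeMem.receive]
    split_ifs <;> simp
  · exact le_rfl

/-- The run up to time `t` depends only on the coins flipped until then. -/
lemma stream_congr (adv : Adversary G) {ω ω' : Tape P n} (t : ℕ)
    (h : ∀ u (i : Fin (P.len n)), (i : ℕ) < ((stream adv ω t).2 u).rank.length →
      ω u i = ω' u i) : stream adv ω t = stream adv ω' t := by
  induction t with
  | zero => rfl
  | succ t ih =>
    have hs := step_congr h
    have := ih fun u i hi => h u i (hi.trans_le (rank_length_le_step _ _ _ u))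
    simp only [stream] at hs ⊢
    rw [← this, hs]

end Stream

/-! ### A product martingale against the adaptive adversary -/

section Martingale

variable {P : Params} {n : ℕ} {G : SimpleGraph (Fin n)}

/-- The weight of a node: it at most doubles its excess over `1` with every coin flip. -/
def NodeMem.weight (P : Params) (r : ℝ) (x : NodeMem n) : ℝ :=
  1 + if x.interesting then r * 2 ^ P.degClass n x.deg else 0

/-- Flips the coin number `ℓ u` of the nodes `u` with `b u = 1`. -/
def flipCoins (ℓ : Fin n → ℕ) (b : Fin n → Bool) (ω : Tape P n) : Tape P n := fun u i =>
  if (i : ℕ) = ℓ u then xor (ω u i) (b u) else ω u i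

lemma flipCoins_flipCoins (ℓ : Fin n → ℕ) (b : Fin n → Bool) (ω : Tape P n) :
    flipCoins ℓ b (flipCoins ℓ b ω) = ω := by
  funext u i
  unfold flipCoins
  split_ifs <;> simp

lemma coin_flipCoins {ℓ : Fin n → ℕ} {b : Fin n → Bool} {ω : Tape P n} {u : Fin n}
    (h : ℓ u < P.len n) :
    coin (flipCoins ℓ b ω) u (ℓ u) = xor (coin ω u (ℓ u)) (b u) := by
  simp [coin, h, flipCoins]

/-- The numbers of coins flipped so far. -/
def flipped (adv : Adversary G) (t : ℕ) (ω : Tape P n) : Fin n → ℕ := fun u =>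
  ((stream adv ω t).2 u).rank.length

lemma stream_flipCoins (adv : Adversary G) (t : ℕ) (b : Fin n → Bool) (ω : Tape P n) :
    stream adv (flipCoins (flipped adv t ω) b ω) t = stream adv ω t := by
  symm
  refine stream_congr adv t fun u i hi => ?_
  have hne : (i : ℕ) ≠ flipped adv t ω u := by
    unfold flipped
    omega
  rw [flipCoins, if_neg hne]

/-- Changing coins that have not been flipped yet changes neither the past nor the number of flipped
coins, so the map is an involution of the tapes. This expresses that the next coins are fair given
the whole past. -/
lemma sum_flipCoins (adv : Adversary G) (t : ℕ) (b : Fin n → Bool) (F : Tape P n → ℝ) :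
    ∑ ω, F (flipCoins (flipped adv t ω) b ω) = ∑ ω, F ω := by
  have hinv : Function.Involutive fun ω : Tape P n => flipCoins (flipped adv t ω) b ω := by
    intro ω
    have h : flipped adv t (flipCoins (flipped adv t ω) b ω) = flipped adv t ω := by
      funext u
      rw [flipped, stream_flipCoins, flipped]
    change flipCoins (flipped adv t (flipCoins (flipped adv t ω) b ω)) b _ = ω
    rw [h, flipCoins_flipCoins]
  exact Equiv.sum_comp hinv.toPerm F

/-- On a class switch of an interesting node, the excess over 1 doubles for coin 0 and vanishes for
coin 1. -/
lemma weight_receive_add (h0 : 1 ≤ P.theta0 n) (r : ℝ) (new : Finset (Fin n)) (x : NodeMem n) :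
    (x.receive P true new).weight P r + (x.receive P false new).weight P r =
      2 * x.weight P r := by
  by_cases hs : P.degClass n (x.deg + 1) = P.degClass n x.deg
  · simp [NodeMem.receive, NodeMem.weight, hs]
    ring
  · simp [NodeMem.receive, NodeMem.weight, degClass_succ h0 hs]
    split_ifs
    · rw [pow_succ]
      ring
    · ring

lemma weight_receive_of_eq (r : ℝ) (b : Bool) (new : Finset (Fin n)) {x : NodeMem n}
    (hs : P.degClass n (x.deg + 1) = P.degClass n x.deg) :
    (x.receive P b new).weight P r = x.weight P r := by
  simp [NodeMem.receive, NodeMem.weight, hs]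

lemma flipped_lt (h0 : 1 ≤ P.theta0 n) (ha : 1 ≤ P.a) (adv : Adversary G) (ω : Tape P n)
    {t : ℕ} (ht : t + 1 ≤ G.edgeFinset.card) {u : Fin n}
    (hu : u ∈ adv.next (stream adv ω t).1)
    (hs : P.degClass n (((stream adv ω t).2 u).deg + 1) ≠
      P.degClass n ((stream adv ω t).2 u).deg) : flipped adv t ω u < P.len n := by
  have h1 := streamSpec h0 ha adv ω ht
  have h2 := streamSpec h0 ha adv ω (Nat.le_of_succ_le ht)
  have hdeg : ((stream adv ω (t + 1)).2 u).deg = ((stream adv ω t).2 u).deg + 1 := by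
    simp [stream, step, hu, NodeMem.receive]
  have hlt : ((stream adv ω (t + 1)).2 u).deg < n := by
    rw [h1.mem_eq]
    exact (listDegree_le_degree h1.nodup h1.mem_edgeSet u).trans_lt (degree_lt G u)
  rw [hdeg] at hlt
  have hle := degClass_le_len h0 ha hlt
  rw [degClass_succ h0 hs] at hle
  have hrank : flipped adv t ω u ≤ P.degClass n ((stream adv ω t).2 u).deg := by
    rw [flipped, h2.mem_eq]
    simp [memAfter]
  omega

/-- With the past fixed, so is the next edge, and the new weight of u depends on `b u` only. The sum
over b of the product is then a product of two-term sums. -/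
lemma sum_weight_flipCoins (h0 : 1 ≤ P.theta0 n) (ha : 1 ≤ P.a) (r : ℝ) (adv : Adversary G)
    (ω : Tape P n) {t : ℕ} (ht : t + 1 ≤ G.edgeFinset.card) :
    ∑ b : Fin n → Bool, ∏ u, ((stream adv (flipCoins (flipped adv t ω) b ω) (t + 1)).2 u).weight
      P r = 2 ^ n * ∏ u, ((stream adv ω t).2 u).weight P r := by
  set m := (stream adv ω t).2 with hm
  set e := adv.next (stream adv ω t).1 with he
  let f : Fin n → Bool → ℝ := fun u b =>
    (if u ∈ e then (m u).receive P
      (if flipped adv t ω u < P.len n then xor (coin ω u (m u).rank.length) b else false)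
      (univ.filter fun v => e = s(u, v)) else m u).weight P r
  have h1 : ∀ b u, ((stream adv (flipCoins (flipped adv t ω) b ω) (t + 1)).2 u).weight P r =
      f u (b u) := by
    intro b u
    have hc : coin (flipCoins (flipped adv t ω) b ω) u (flipped adv t ω u) =
        if flipped adv t ω u < P.len n then xor (coin ω u (m u).rank.length) (b u)
        else false := by
      split_ifs with h
      · exact coin_flipCoins h
      · rw [coin, dif_neg h]
    simp only [stream, stream_flipCoins, step, f]
    rw [← hm, ← he, ← hc]
    rfl
  have h2 : ∀ u, ∑ b, f u b = 2 * (m u).weight P r := by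
    intro u
    rw [Fintype.sum_bool]
    simp only [f]
    by_cases hu : u ∈ e
    · simp only [hu, if_true]
      by_cases hs : P.degClass n ((m u).deg + 1) = P.degClass n (m u).deg
      · rw [weight_receive_of_eq r _ _ hs, weight_receive_of_eq r _ _ hs, two_mul]
      · simp only [flipped_lt h0 ha adv ω ht hu hs, if_true]
        rw [← weight_receive_add h0 r (univ.filter fun v => e = s(u, v)) (m u)]
        cases coin ω u (m u).rank.length
        · simp
        · simp [add_comm]
    · simp only [hu, if_false, two_mul]
  simp only [h1]
  have h3 := prod_univ_sum (fun _ : Fin n => (univ : Finset Bool)) f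
  rw [Fintype.piFinset_univ] at h3
  rw [← h3]
  simp only [h2, prod_mul_distrib, prod_const, card_univ, Fintype.card_fin]

/-- The product of the weights is a martingale. -/
lemma sum_prod_weight (h0 : 1 ≤ P.theta0 n) (ha : 1 ≤ P.a) (r : ℝ) (adv : Adversary G)
    {t : ℕ} (ht : t ≤ G.edgeFinset.card) :
    ∑ ω : Tape P n, ∏ u, ((stream adv ω t).2 u).weight P r =
      Fintype.card (Tape P n) * (1 + r) ^ n := by
  induction t with
  | zero =>
    simp [stream, initMem, NodeMem.weight, degClass_zero]
  | succ t ih =>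
    rw [← ih (by omega)]
    -- Each tape is averaged over all 2^n choices of b; after exchanging the sums, every b
    -- contributes the same amount.
    have h2 : (2 : ℝ) ^ n ≠ 0 := by positivity
    refine mul_left_cancel₀ h2 ?_
    conv_rhs =>
      rw [mul_sum, ← sum_congr rfl fun ω _ => sum_weight_flipCoins h0 ha r adv ω ht, sum_comm,
        sum_congr rfl fun b _ => sum_flipCoins adv t b fun ω : Tape P n =>
          ∏ u, ((stream adv ω (t + 1)).2 u).weight P r]
    simp

lemma card_nbrs_le_deg {adv : Adversary G} {ω : Tape P n} {t : ℕ} (h : StreamSpec adv ω t)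
    (u : Fin n) : ((stream adv ω t).2 u).nbrs.card ≤ ((stream adv ω t).2 u).deg := by
  rw [h.mem_eq]
  simp only [memAfter]
  split_ifs
  · rw [listDegree]
    refine le_trans ?_ (List.toFinset_card_le _)
    refine card_le_card_of_injOn (fun v => s(u, v)) ?_ ?_
    · intro v hv
      replace hv := (mem_filter.1 (mem_coe.1 hv)).2
      refine mem_coe.2 ?_
      simp [hv]
    · intro v _ v' _ hvv
      exact Sym2.congr_right.1 hvv
  · exact Nat.zero_le _

lemma nbrs_eq_empty {adv : Adversary G} {ω : Tape P n} {t : ℕ} (h : StreamSpec adv ω t)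
    {u : Fin n} (hu : ((stream adv ω t).2 u).interesting = false) :
    ((stream adv ω t).2 u).nbrs = ∅ := by
  rw [h.mem_eq] at hu ⊢
  simp only [memAfter, decide_eq_false_iff_not] at hu ⊢
  rw [if_neg hu]

lemma exp_half_le {w : ℝ} (h0 : 0 ≤ w) (h2 : w ≤ 2) : Real.exp (w / 2) ≤ 1 + w := by
  have h := Real.abs_exp_sub_one_le (x := w / 2) (by rw [abs_of_nonneg] <;> linarith)
  rw [abs_of_nonneg (by linarith : 0 ≤ w / 2)] at h
  have := (abs_le.1 h).2
  linarith

/-- An interesting node of class j holds at most 2^j θ_0 copies, and the others hold none. With w =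
2^j θ_0 / n, a factor is at most e^{w/2} ≤ 1 + w. This needs w ≤ 2, which holds because a degree
below n exceeds half of its class's upper end, or because θ_0 < n if j = 0. -/
lemma exp_sum_nbrs_le (h0 : 1 ≤ P.theta0 n) (hn : P.theta0 n < n) {adv : Adversary G}
    {ω : Tape P n} {t : ℕ} (h : StreamSpec adv ω t) :
    Real.exp ((∑ u, ((stream adv ω t).2 u).nbrs.card : ℕ) / (2 * n)) ≤
      ∏ u, ((stream adv ω t).2 u).weight P (P.theta0 n / n) := by
  have hn0 : (0 : ℝ) < n := by exact_mod_cast (Nat.zero_le _).trans_lt hn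
  rw [Nat.cast_sum, sum_div, Real.exp_sum]
  refine prod_le_prod (fun u _ => Real.exp_nonneg _) fun u _ => ?_
  set x := (stream adv ω t).2 u with hx
  cases hi : x.interesting
  · rw [nbrs_eq_empty h hi, NodeMem.weight, hi]
    simp
  · have hdn : x.deg < n := by
      rw [hx, h.mem_eq]
      exact (listDegree_le_degree h.nodup h.mem_edgeSet u).trans_lt (degree_lt G u)
    have hd : x.nbrs.card ≤ 2 ^ P.degClass n x.deg * P.theta0 n := by
      rw [← theta_eq]
      exact (card_nbrs_le_deg h u).trans ((degClass_le_iff h0).1 le_rfl)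
    have hw2 : 2 ^ P.degClass n x.deg * P.theta0 n ≤ 2 * n := by
      rcases hj : P.degClass n x.deg with _ | j
      · omega
      · have := lt_of_degClass_eq_succ h0 hj
        rw [pow_succ, mul_comm (2 ^ j) 2, mul_assoc]
        omega
    have hd' : (x.nbrs.card : ℝ) ≤ 2 ^ P.degClass n x.deg * P.theta0 n := by exact_mod_cast hd
    have hw2' : (2 : ℝ) ^ P.degClass n x.deg * P.theta0 n ≤ 2 * n := by exact_mod_cast hw2
    set w : ℝ := P.theta0 n / n * 2 ^ P.degClass n x.deg with hw
    have hwn : w * n = 2 ^ P.degClass n x.deg * P.theta0 n := by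
      rw [hw]
      field_simp
    have hle : w ≤ 2 := le_of_mul_le_mul_right (by rw [hwn]; exact hw2') hn0
    have h1 : (x.nbrs.card : ℝ) / (2 * n) ≤ w / 2 := by
      rw [div_le_div_iff₀ (by positivity) two_pos]
      nlinarith
    calc Real.exp ((x.nbrs.card : ℝ) / (2 * n)) ≤ Real.exp (w / 2) := Real.exp_le_exp.2 h1
      _ ≤ 1 + w := exp_half_le (by positivity) hle
      _ = x.weight P (P.theta0 n / n) := by rw [NodeMem.weight, hi]; simp [hw]

/-- At a fixed time, it is unlikely that many copies of edges are stored. -/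
lemma card_heavy_le (h0 : 1 ≤ P.theta0 n) (ha : 1 ≤ P.a) (adv : Adversary G) {t : ℕ}
    (ht : t ≤ G.edgeFinset.card) :
    ((univ.filter fun ω : Tape P n =>
      4 * n * P.theta0 n < ∑ u, ((stream adv ω t).2 u).nbrs.card).card : ℝ) ≤
      Real.exp (-(P.theta0 n : ℝ)) * Fintype.card (Tape P n) := by
  rcases lt_or_ge (P.theta0 n) n with hn | hn
  · have hn0 : (0 : ℝ) < n := by exact_mod_cast (Nat.zero_le _).trans_lt hn
    set B := univ.filter fun ω : Tape P n =>
      4 * n * P.theta0 n < ∑ u, ((stream adv ω t).2 u).nbrs.card with hB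
    set r : ℝ := P.theta0 n / n with hr
    have hM : ∀ ω : Tape P n, 0 ≤ ∏ u, ((stream adv ω t).2 u).weight P r := fun ω =>
      (Real.exp_nonneg _).trans (exp_sum_nbrs_le h0 hn (streamSpec h0 ha adv ω ht))
    -- Markov: on `B` the product is at least e^{2θ_0}, while its mean (1 + θ_0/n)^n is at most
    -- e^{θ_0}.
    have h1 : B.card * Real.exp (2 * P.theta0 n) ≤
        Fintype.card (Tape P n) * Real.exp (P.theta0 n) := by
      calc B.card * Real.exp (2 * P.theta0 n)
          = ∑ ω ∈ B, Real.exp (2 * P.theta0 n) := by rw [sum_const, nsmul_eq_mul]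
        _ ≤ ∑ ω ∈ B, ∏ u, ((stream adv ω t).2 u).weight P r := by
            refine sum_le_sum fun ω hω => ?_
            refine le_trans (Real.exp_le_exp.2 ?_)
              (exp_sum_nbrs_le h0 hn (streamSpec h0 ha adv ω ht))
            rw [le_div_iff₀ (by positivity)]
            have := (mem_filter.1 hω).2.le
            have h' : ((4 * n * P.theta0 n : ℕ) : ℝ) ≤
              (∑ u, ((stream adv ω t).2 u).nbrs.card : ℕ) := by exact_mod_cast this
            push_cast at h' ⊢
            linarith
        _ ≤ ∑ ω, ∏ u, ((stream adv ω t).2 u).weight P r :=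
            sum_le_sum_of_subset_of_nonneg (subset_univ _) fun ω _ _ => hM ω
        _ = Fintype.card (Tape P n) * (1 + r) ^ n := sum_prod_weight h0 ha r adv ht
        _ ≤ Fintype.card (Tape P n) * Real.exp (P.theta0 n) := by
            refine mul_le_mul_of_nonneg_left ?_ (Nat.cast_nonneg _)
            have h2 : 1 + r ≤ Real.exp r := by
              have := Real.add_one_le_exp r
              linarith
            calc (1 + r) ^ n ≤ Real.exp r ^ n :=
                  pow_le_pow_left₀ (by positivity) h2 n
              _ = Real.exp (P.theta0 n) := by
                  rw [← Real.exp_nat_mul, hr]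
                  congr 1
                  field_simp
    have h2 : Real.exp (P.theta0 n : ℝ) =
        Real.exp (-(P.theta0 n : ℝ)) * Real.exp (2 * P.theta0 n) := by
      rw [← Real.exp_add]
      congr 1
      ring
    rw [h2, ← mul_assoc] at h1
    have := le_of_mul_le_mul_right h1 (Real.exp_pos _)
    linarith
  · have : (univ.filter fun ω : Tape P n =>
        4 * n * P.theta0 n < ∑ u, ((stream adv ω t).2 u).nbrs.card) = ∅ := by
      refine filter_eq_empty_iff.2 fun ω _ h => ?_
      have hs := streamSpec h0 ha adv ω ht
      have h1 : ∑ u, ((stream adv ω t).2 u).nbrs.card ≤ ∑ _u : Fin n, n := by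
        refine sum_le_sum fun u _ => (card_nbrs_le_deg hs u).trans ?_
        rw [hs.mem_eq]
        exact ((listDegree_le_degree hs.nodup hs.mem_edgeSet u).trans_lt (degree_lt G u)).le
      rw [sum_const, card_univ, Fintype.card_fin, smul_eq_mul] at h1
      have h2 : n * n ≤ n * P.theta0 n := Nat.mul_le_mul_left _ hn
      have h3 : 4 * n * P.theta0 n = 4 * (n * P.theta0 n) := by ring
      omega
    rw [this, card_empty, Nat.cast_zero]
    positivity

end Martingale

/-! ### From copies of edges to words -/

section Words

variable {P : Params} {n : ℕ} {G : SimpleGraph (Fin n)}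

lemma logb_le_wordBits (hn : 0 < n) : Real.logb 2 n ≤ wordBits n := by
  have h := Nat.lt_pow_succ_log_self one_lt_two n
  rw [Real.logb_le_iff_le_rpow one_lt_two (by exact_mod_cast hn), Real.rpow_natCast]
  exact_mod_cast h.le

lemma len_le (hn : 0 < n) : P.len n ≤ P.a * wordBits n := by
  refine Nat.ceil_le.2 ?_
  push_cast
  exact mul_le_mul_of_nonneg_left (logb_le_wordBits hn) (Nat.cast_nonneg _)

lemma words_le (hn : 0 < n) {m : Memory n} {B : ℕ} (hB : ∑ u, (m u).nbrs.card ≤ B)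
    (hr : ∀ u, (m u).rank.length ≤ P.len n) : words m ≤ 2 + 2 * B + n * (P.a + 5) := by
  have h : ∀ u, (m u).words ≤ 2 * (m u).nbrs.card + (P.a + 5) := by
    intro u
    have hc : ⌈((m u).rank.length : ℚ) / wordBits n⌉₊ ≤ P.a := by
      refine Nat.ceil_le.2 ?_
      rw [div_le_iff₀ (by unfold wordBits; positivity)]
      exact_mod_cast (hr u).trans (len_le hn)
    unfold NodeMem.words
    omega
  have h2 := sum_le_sum fun u (_ : u ∈ univ) => h u
  rw [sum_add_distrib, ← mul_sum, sum_const, card_univ, Fintype.card_fin, smul_eq_mul] at h2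
  unfold words
  omega

lemma nbrs_mis (m : Memory n) (i : ℕ) (u : Fin n) : (mis m i u).nbrs = (m u).nbrs := by
  induction i with
  | zero => rfl
  | succ i ih => exact ih

lemma rank_mis (m : Memory n) (i : ℕ) (u : Fin n) : (mis m i u).rank = (m u).rank := by
  induction i with
  | zero => rfl
  | succ i ih => exact ih

/-- The phases after the stream only delete copies, and a full rank packs into `P.a` words. So it
suffices to control the copies during the stream. -/
lemma words_trace_le (h0 : 1 ≤ P.theta0 n) (ha : 1 ≤ P.a) (hn : 0 < n) {adv : Adversary G}
    {ω : Tape P n} {B : ℕ}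
    (hB : ∀ t ≤ G.edgeFinset.card, ∑ u, ((stream adv ω t).2 u).nbrs.card ≤ B) :
    ∀ m ∈ trace adv ω, words m ≤ 2 + 2 * B + n * (P.a + 5) := by
  have hrank : ∀ t ≤ G.edgeFinset.card, ∀ u,
      ((stream adv ω t).2 u).rank.length ≤ P.len n := by
    intro t ht u
    rw [(streamSpec h0 ha adv ω ht).mem_eq]
    simp [memAfter]
  have hend := hB _ le_rfl
  have hfill : ∀ u, (fillRanks ω (endOfStream adv ω) u).rank.length ≤ P.len n := by
    intro u
    have : (endOfStream adv ω u).rank.length ≤ P.len n := hrank _ le_rfl u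
    simp only [fillRanks, List.length_append, List.length_drop, List.length_ofFn]
    omega
  have hprune : ∑ u, (pruned adv ω u).nbrs.card ≤ B := by
    refine le_trans (sum_le_sum fun u _ => card_le_card ?_) hend
    simp only [pruned, prune]
    split_ifs
    · exact subset_rfl
    · exact empty_subset _
  have hmis : ∀ i, ∑ u, (mis (pruned adv ω) i u).nbrs.card ≤ B := by
    intro i
    simp only [nbrs_mis]
    exact hprune
  have hmisr : ∀ i u, (mis (pruned adv ω) i u).rank.length ≤ P.len n := by
    intro i u
    rw [rank_mis]
    exact hfill u
  intro m hm
  simp only [trace, List.mem_append, List.mem_map, List.mem_range, List.mem_cons,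
    List.not_mem_nil, or_false] at hm
  rcases hm with ((⟨t, ht, rfl⟩ | rfl | rfl) | ⟨i, _, rfl⟩) | rfl
  · exact words_le hn (hB t (by omega)) (hrank t (by omega))
  · exact words_le hn hend hfill
  · exact words_le hn hend hfill
  · exact words_le hn (hmis i) (hmisr i)
  · exact words_le hn (hmis n) (hmisr n)

/-- With high probability, the memory is small at all times. -/
lemma card_large_memory_le (h0 : 1 ≤ P.theta0 n) (ha : 1 ≤ P.a) (hn : 0 < n)
    (adv : Adversary G) :
    ((univ.filter fun ω : Tape P n => ¬ ∀ m ∈ trace adv ω,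
      words m ≤ 2 + 2 * (4 * n * P.theta0 n) + n * (P.a + 5)).card : ℝ) ≤
      (G.edgeFinset.card + 1) * (Real.exp (-(P.theta0 n : ℝ)) * Fintype.card (Tape P n)) := by
  let H : ℕ → Finset (Tape P n) := fun t => univ.filter fun ω : Tape P n =>
      4 * n * P.theta0 n < ∑ u, ((stream adv ω t).2 u).nbrs.card
  have hsub : (univ.filter fun ω : Tape P n => ¬ ∀ m ∈ trace adv ω,
      words m ≤ 2 + 2 * (4 * n * P.theta0 n) + n * (P.a + 5)) ⊆
      (range (G.edgeFinset.card + 1)).biUnion H := by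
    intro ω hω
    replace hω := (mem_filter.1 hω).2
    by_contra hc
    refine hω (words_trace_le h0 ha hn fun t ht => ?_)
    by_contra! hlt
    exact hc (mem_biUnion.2 ⟨t, mem_range.2 (by omega), mem_filter.2 ⟨mem_univ _, hlt⟩⟩)
  have h1 := (card_le_card hsub).trans card_biUnion_le
  calc _ ≤ ((∑ t ∈ range (G.edgeFinset.card + 1), (H t).card : ℕ) : ℝ) := by exact_mod_cast h1
    _ = ∑ t ∈ range (G.edgeFinset.card + 1), ((H t).card : ℝ) := by push_cast; rfl
    _ ≤ ∑ _t ∈ range (G.edgeFinset.card + 1),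
        Real.exp (-(P.theta0 n : ℝ)) * Fintype.card (Tape P n) :=
      sum_le_sum fun t ht => card_heavy_le h0 ha adv (by rw [mem_range] at ht; omega)
    _ = _ := by rw [sum_const, card_range, nsmul_eq_mul]; push_cast; rfl

end Words

/-! ### Lexicographic comparison of bit strings -/

section Ranks

lemma rankValue_append (l l' : List Bool) :
    rankValue (l ++ l') = rankValue l * 2 ^ l'.length + rankValue l' := by
  induction l' using List.reverseRecOn with
  | nil => simp [rankValue]
  | append_singleton l' b ih =>
    rw [← List.append_assoc]
    unfold rankValue at *
    rw [List.foldl_append, List.foldl_append (l := l'), ih]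
    simp only [List.foldl_cons, List.foldl_nil, List.length_append, List.length_cons,
      List.length_nil]
    ring

lemma rankValue_cons (b : Bool) (l : List Bool) :
    rankValue (b :: l) = b.toNat * 2 ^ l.length + rankValue l := by
  have := rankValue_append [b] l
  simpa [rankValue] using this

lemma rankValue_lt (l : List Bool) : rankValue l < 2 ^ l.length := by
  induction l with
  | nil => simp [rankValue]
  | cons b l ih =>
    rw [rankValue_cons, List.length_cons, pow_succ]
    cases b <;> simp <;> omega

lemma rankValue_injective {l l' : List Bool} (hl : l.length = l'.length)
    (h : rankValue l = rankValue l') : l = l' := by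
  induction l generalizing l' with
  | nil => exact (List.length_eq_zero_iff.1 hl.symm).symm
  | cons b l ih =>
    rcases l' with _ | ⟨b', l'⟩
    · simp at hl
    have hl' : l.length = l'.length := by simpa using hl
    rw [rankValue_cons, rankValue_cons, hl'] at h
    have h1 := rankValue_lt l
    have h2 := rankValue_lt l'
    rw [hl'] at h1
    cases b <;> cases b' <;> simp at h
    · rw [ih hl' h]
    · omega
    · omega
    · rw [ih hl' h]

lemma rankValue_lt_of_forall {l : List Bool} {j : ℕ} (hj : j ≤ l.length)
    (h : ∀ b ∈ l.take j, b = false) : rankValue l < 2 ^ (l.length - j) := by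
  induction j generalizing l with
  | zero => exact rankValue_lt l
  | succ j ih =>
    rcases l with _ | ⟨b, l⟩
    · simp at hj
    rw [List.take_succ_cons] at h
    have hb : b = false := h b List.mem_cons_self
    have := ih (l := l) (by simpa using hj) fun b hb => h b (List.mem_cons_of_mem _ hb)
    rw [rankValue_cons, hb, List.length_cons, Nat.add_sub_add_right]
    simpa using this

lemma le_rankValue_of_exists {l : List Bool} {j : ℕ} (h : true ∈ l.take j) :
    2 ^ (l.length - j) ≤ rankValue l := by
  induction j generalizing l with
  | zero => simp at h
  | succ j ih =>
    rcases l with _ | ⟨b, l⟩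
    · simp at h
    rw [List.take_succ_cons] at h
    rw [rankValue_cons, List.length_cons, Nat.add_sub_add_right]
    rcases List.mem_cons.1 h with h | h
    · rw [← h, Bool.toNat_true, one_mul]
      exact (Nat.pow_le_pow_right two_pos (Nat.sub_le _ _)).trans (Nat.le_add_right _ _)
    · exact (ih h).trans (Nat.le_add_left _ _)

end Ranks

/-! ### The permutation defined by the ranks -/

section Order

variable {P : Params} {n : ℕ}

/-- The completed rank of `u`, read as a number. -/
def rankNum (ω : Tape P n) (u : Fin n) : ℕ := rankValue (List.ofFn (ω u))

lemma rankNum_eq_iff {ω : Tape P n} {u v : Fin n} : rankNum ω u = rankNum ω v ↔ ω u = ω v := by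
  constructor
  · intro h
    exact List.ofFn_injective (rankValue_injective (by simp) h)
  · intro h
    rw [rankNum, h, rankNum]

/-- The link between the two roles of the coins: nodes that have kept flipping 0 precede every node
that has flipped a 1. -/
lemma rankNum_lt_of_prefixZero {ω : Tape P n} {u v : Fin n} {j : ℕ} (hj : j ≤ P.len n)
    (hu : PrefixZero ω u j) (hv : ¬ PrefixZero ω v j) : rankNum ω u < rankNum ω v := by
  have h1 : rankNum ω u < 2 ^ ((List.ofFn (ω u)).length - j) := by
    refine rankValue_lt_of_forall (by simpa using hj) fun b hb => ?_
    obtain ⟨i, hi, rfl⟩ := List.mem_take_iff_getElem.1 hb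
    rw [List.getElem_ofFn]
    simp only [List.length_ofFn] at hi
    exact hu _ (by simp; omega)
  have h2 : 2 ^ ((List.ofFn (ω v)).length - j) ≤ rankNum ω v := by
    refine le_rankValue_of_exists ?_
    unfold PrefixZero at hv
    push Not at hv
    obtain ⟨i, hi, hb⟩ := hv
    refine List.mem_take_iff_getElem.2 ⟨i, by simp [hi], ?_⟩
    rw [List.getElem_ofFn]
    simpa using hb
  simp only [List.length_ofFn] at h1 h2
  exact h1.trans_le h2

def Precedes (ω : Tape P n) (v u : Fin n) : Prop :=
  rankNum ω v < rankNum ω u ∨ rankNum ω v = rankNum ω u ∧ v ≤ u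

/-- The position of `u` in the order of the ranks. -/
def position (ω : Tape P n) (u : Fin n) : ℕ := (univ.filter fun v => Precedes ω v u).card

lemma position_pos (ω : Tape P n) (u : Fin n) : 0 < position ω u :=
  card_pos.2 ⟨u, mem_filter.2 ⟨mem_univ _, Or.inr ⟨rfl, le_rfl⟩⟩⟩

lemma position_le (ω : Tape P n) (u : Fin n) : position ω u ≤ n := by
  have := card_le_univ (univ.filter fun v => Precedes ω v u)
  rwa [Fintype.card_fin] at this

lemma position_lt {ω : Tape P n} {u v : Fin n} (hvu : ¬ Precedes ω v u) :
    position ω u < position ω v := by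
  refine card_lt_card ?_
  rw [ssubset_iff_of_subset]
  · exact ⟨v, mem_filter.2 ⟨mem_univ _, Or.inr ⟨rfl, le_rfl⟩⟩,
      fun h => hvu (mem_filter.1 h).2⟩
  · intro w hw
    replace hw := (mem_filter.1 hw).2
    refine mem_filter.2 ⟨mem_univ _, ?_⟩
    unfold Precedes at *
    omega

lemma position_injective (ω : Tape P n) : Function.Injective (position ω) := by
  intro u v h
  by_contra hne
  have : ¬ Precedes ω v u ∨ ¬ Precedes ω u v := by
    unfold Precedes
    omega
  rcases this with h' | h'
  · exact absurd h (position_lt h').ne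
  · exact absurd h (position_lt h').ne'

/-- The order of the ranks, with positions counted from `0`. -/
def order (ω : Tape P n) : Equiv.Perm (Fin n) :=
  Equiv.ofBijective
    (fun u => ⟨position ω u - 1, by
      have := position_pos ω u
      have := position_le ω u
      omega⟩)
    (Finite.injective_iff_bijective.1 fun u v h => by
      have h1 := position_pos ω u
      have h2 := position_pos ω v
      have h3 : position ω u - 1 = position ω v - 1 := Fin.mk.inj_iff.1 h
      exact position_injective ω (by omega))

lemma order_add_one (ω : Tape P n) (u : Fin n) : (order ω u : ℕ) + 1 = position ω u := by
  have := position_pos ω u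
  change position ω u - 1 + 1 = _
  omega

/-- Ties are broken by names, which a renaming does not preserve; this is why the ranks have to be
distinct. -/
lemma order_comp {ω : Tape P n} (hω : Function.Injective ω) (ρ : Equiv.Perm (Fin n)) :
    order (ω ∘ ρ : Tape P n) = order ω * ρ := by
  ext u
  have h : position (ω ∘ ρ : Tape P n) u = position ω (ρ u) := by
    have hp : ∀ ω : Tape P n, Function.Injective ω → ∀ v u,
        Precedes ω v u ↔ rankNum ω v ≤ rankNum ω u := by
      intro ω hω v u
      have h1 : rankNum ω v = rankNum ω u → v = u := fun h => hω (rankNum_eq_iff.1 h)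
      unfold Precedes
      constructor
      · omega
      · intro h
        rcases h.lt_or_eq with h | h
        · exact Or.inl h
        · exact Or.inr ⟨h, (h1 h).le⟩
    unfold position
    refine card_bij (fun v _ => ρ v) ?_ (fun v _ v' _ h => ρ.injective h) ?_
    · intro v hv
      simp only [mem_filter, mem_univ, true_and] at hv ⊢
      rw [hp _ (hω.comp ρ.injective)] at hv
      rw [hp _ hω]
      exact hv
    · intro v hv
      simp only [mem_filter, mem_univ, true_and] at hv
      refine ⟨ρ.symm v, ?_, ρ.apply_symm_apply v⟩
      simp only [mem_filter, mem_univ, true_and]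
      rw [hp _ (hω.comp ρ.injective)]
      rw [hp _ hω] at hv
      simpa [rankNum] using hv
  have h1 := order_add_one (ω ∘ ρ : Tape P n) u
  have h2 := order_add_one ω (ρ u)
  rw [Equiv.Perm.mul_apply]
  omega

end Order

/-! ### The algorithm simulates the sequential process -/

section Output

variable {P : Params} {n : ℕ} {G : SimpleGraph (Fin n)}

/-- The first time, counted from `0`, at which a node of degree `d` is too late. -/
def timeout (P : Params) (n d : ℕ) : ℕ :=
  if d = 0 then n else ⌈P.c / P.ε * (n * Real.logb 2 n) / d⌉₊ - 1

/-- Positions shift from 1-based to 0-based: p + 1 < τ means p < ⌈τ⌉ − 1. For degree 0 the deadline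
n acts as infinity. -/
lemma below_iff (hX : 0 < P.c / P.ε * (n * Real.logb 2 n)) {p d : ℕ} (hp : p < n) :
    P.below n (p + 1) d ↔ p < timeout P n d := by
  unfold Params.below timeout
  split_ifs with hd
  · subst hd
    simp only [Nat.cast_zero, mul_zero]
    exact iff_of_true hX hp
  · have hd' : (0 : ℝ) < d := by exact_mod_cast Nat.pos_of_ne_zero hd
    rw [← lt_div_iff₀ hd', ← Nat.lt_ceil]
    omega

/-- Nodes that come early have not become uninteresting during the stream. -/
def EarlyInteresting (G : SimpleGraph (Fin n)) (ω : Tape P n) : Prop :=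
  ∀ u, P.below n (position ω u) (G.degree u) → PrefixZero ω u (P.degClass n (G.degree u))

lemma fillRanks_rank (h0 : 1 ≤ P.theta0 n) (ha : 1 ≤ P.a) (adv : Adversary G) (ω : Tape P n)
    (u : Fin n) : (fillRanks ω (endOfStream adv ω) u).rank = List.ofFn (ω u) := by
  have hl := degClass_le_len h0 ha (degree_lt G u)
  simp only [fillRanks, endOfStream_eq h0 ha adv ω]
  rw [List.length_take, List.length_ofFn, min_eq_left hl, List.take_append_drop]

lemma pruned_pos (h0 : 1 ≤ P.theta0 n) (ha : 1 ≤ P.a) (adv : Adversary G) (ω : Tape P n)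
    (u : Fin n) : (pruned adv ω u).pos = position ω u := by
  simp only [pruned, prune, setPositions, fillRanks_rank h0 ha adv ω, position, Precedes, rankNum]
  congr

lemma pruned_deg (h0 : 1 ≤ P.theta0 n) (ha : 1 ≤ P.a) (adv : Adversary G) (ω : Tape P n)
    (u : Fin n) : (pruned adv ω u).deg = G.degree u := by
  simp only [pruned, prune, setPositions, fillRanks, endOfStream_eq h0 ha adv ω]

lemma pruned_interesting (h0 : 1 ≤ P.theta0 n) (ha : 1 ≤ P.a)
    (hX : 0 < P.c / P.ε * (n * Real.logb 2 n)) (adv : Adversary G) {ω : Tape P n}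
    (hω : EarlyInteresting G ω) (u : Fin n) :
    (pruned adv ω u).interesting = true ↔ (order ω u : ℕ) < timeout P n (G.degree u) := by
  rw [← below_iff hX (order ω u).2, order_add_one]
  have h1 : (pruned adv ω u).interesting =
      ((endOfStream adv ω u).interesting &&
        decide (P.below n (pruned adv ω u).pos (pruned adv ω u).deg)) := rfl
  rw [h1, pruned_pos h0 ha, pruned_deg h0 ha, endOfStream_eq h0 ha]
  simp only [Bool.and_eq_true, decide_eq_true_eq]
  exact ⟨fun h => h.2, fun h => ⟨hω u h, h⟩⟩

lemma pruned_nbrs (h0 : 1 ≤ P.theta0 n) (ha : 1 ≤ P.a) (adv : Adversary G) {ω : Tape P n}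
    {u : Fin n} (hu : (pruned adv ω u).interesting = true) (v : Fin n) :
    v ∈ (pruned adv ω u).nbrs ↔ G.Adj u v := by
  have h1 : (pruned adv ω u).nbrs =
      if (pruned adv ω u).interesting then (endOfStream adv ω u).nbrs else ∅ := rfl
  have h2 : (endOfStream adv ω u).interesting = true := by
    have : (pruned adv ω u).interesting =
      ((endOfStream adv ω u).interesting &&
        decide (P.below n (pruned adv ω u).pos (pruned adv ω u).deg)) := rfl
    rw [this, Bool.and_eq_true] at hu
    exact hu.1
  rw [h1, if_pos hu]
  rw [endOfStream_eq h0 ha] at h2 ⊢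
  simp only [decide_eq_true_eq] at h2
  simp [h2]

lemma pos_mis (m : Memory n) (i : ℕ) (u : Fin n) : (mis m i u).pos = (m u).pos := by
  induction i with
  | zero => rfl
  | succ i ih => exact ih

lemma deg_mis (m : Memory n) (i : ℕ) (u : Fin n) : (mis m i u).deg = (m u).deg := by
  induction i with
  | zero => rfl
  | succ i ih => exact ih

lemma interesting_mis (m : Memory n) (i : ℕ) (u : Fin n) :
    (mis m i u).interesting = (m u).interesting := by
  induction i with
  | zero => rfl
  | succ i ih => exact ih

/-- The deadlines of the nodes. -/
def deadline (P : Params) (G : SimpleGraph (Fin n)) : Fin n → ℕ := fun v =>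
  timeout P n (G.degree v)

/-- Under `EarlyInteresting` the interesting nodes are exactly those placed before their own
deadline, and they hold all their edges. Both procedures then accept such a node if and only if it
has no earlier pivot neighbour. -/
lemma pivot_mis (h0 : 1 ≤ P.theta0 n) (ha : 1 ≤ P.a)
    (hX : 0 < P.c / P.ε * (n * Real.logb 2 n)) (adv : Adversary G) {ω : Tape P n}
    (hω : EarlyInteresting G ω) (i : ℕ) (u : Fin n) :
    (mis (pruned adv ω) i u).pivot = true ↔
      (order ω u : ℕ) < i ∧ IsPivot G (deadline P G) (order ω) u := by
  induction i generalizing u with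
  | zero =>
    have : (endOfStream adv ω u).pivot = false := by rw [endOfStream_eq h0 ha]
    change (endOfStream adv ω u).pivot = true ↔ _
    simp [this]
  | succ i ih =>
    have hstep : (mis (pruned adv ω) (i + 1) u).pivot =
        ((mis (pruned adv ω) i u).pivot ||
          decide ((mis (pruned adv ω) i u).pos = i + 1 ∧
            (mis (pruned adv ω) i u).interesting = true ∧
            ∀ v ∈ (mis (pruned adv ω) i u).nbrs, (mis (pruned adv ω) i v).pivot = false)) := rfl
    rw [hstep, Bool.or_eq_true, decide_eq_true_eq, ih, pos_mis, interesting_mis, nbrs_mis,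
      pruned_pos h0 ha, ← order_add_one]
    have key : (order ω u : ℕ) = i → (((pruned adv ω u).interesting = true ∧
        ∀ v ∈ (pruned adv ω u).nbrs, (mis (pruned adv ω) i v).pivot = false) ↔
        IsPivot G (deadline P G) (order ω) u) := by
      intro hi
      rw [IsPivot, mem_alive, pruned_interesting h0 ha hX adv hω]
      refine and_congr_right fun hint => ?_
      have hint' := (pruned_interesting h0 ha hX adv hω u).2 hint
      constructor
      · rintro h w hw hlt (rfl | hadj)
        · exact lt_irrefl _ hlt
        · have := h w ((pruned_nbrs h0 ha adv hint' w).2 hadj.symm)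
          rw [← Bool.not_eq_true, ih] at this
          exact this ⟨by omega, hw⟩
      · intro h v hv
        rw [← Bool.not_eq_true, ih]
        rintro ⟨h1, h2⟩
        exact h v h2 (by omega) (Or.inr ((pruned_nbrs h0 ha adv hint' v).1 hv).symm)
    constructor
    · rintro (h | h)
      · exact ⟨by omega, h.2⟩
      · exact ⟨by omega, (key (by omega)).1 h.2⟩
    · rintro ⟨h1, h2⟩
      rcases Nat.lt_succ_iff_lt_or_eq.1 h1 with h | h
      · exact Or.inl ⟨h, h2⟩
      · exact Or.inr ⟨by omega, (key h).2 h2⟩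

lemma isFirstPivot_iff (h0 : 1 ≤ P.theta0 n) (ha : 1 ≤ P.a)
    (hX : 0 < P.c / P.ε * (n * Real.logb 2 n)) (adv : Adversary G) {ω : Tape P n}
    (hω : EarlyInteresting G ω) (v u : Fin n) :
    IsFirstPivot (mis (pruned adv ω) n) v u ↔
      (IsPivot G (deadline P G) (order ω) u ∧ G.Adj u v) ∧
        ∀ w, IsPivot G (deadline P G) (order ω) w → G.Adj w v → order ω u ≤ order ω w := by
  have hpiv : ∀ u, (mis (pruned adv ω) n u).pivot = true ↔
      IsPivot G (deadline P G) (order ω) u := by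
    intro u
    rw [pivot_mis h0 ha hX adv hω]
    exact and_iff_right (order ω u).2
  have hnb : ∀ u, IsPivot G (deadline P G) (order ω) u →
      (v ∈ (mis (pruned adv ω) n u).nbrs ↔ G.Adj u v) := by
    intro u hu
    rw [nbrs_mis]
    exact pruned_nbrs h0 ha adv ((pruned_interesting h0 ha hX adv hω u).2 (mem_alive.1 hu).1) v
  have hpos : ∀ u w, (mis (pruned adv ω) n u).pos ≤ (mis (pruned adv ω) n w).pos ↔
      order ω u ≤ order ω w := by
    intro u w
    rw [pos_mis, pos_mis, pruned_pos h0 ha, pruned_pos h0 ha, ← order_add_one, ← order_add_one,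
      Fin.le_def]
    omega
  unfold IsFirstPivot
  simp only [hpiv, hpos]
  constructor
  · rintro ⟨⟨h1, h2⟩, h3⟩
    exact ⟨⟨h1, (hnb u h1).1 h2⟩, fun w hw hadj => h3 w hw ((hnb w hw).2 hadj)⟩
  · rintro ⟨⟨h1, h2⟩, h3⟩
    exact ⟨⟨h1, (hnb u h1).2 h2⟩, fun w hw hadj => h3 w hw ((hnb w hw).1 hadj)⟩

/-- The algorithm computes the clustering of the sequential greedy process. -/
lemma final_label (h0 : 1 ≤ P.theta0 n) (ha : 1 ≤ P.a)
    (hX : 0 < P.c / P.ε * (n * Real.logb 2 n)) (adv : Adversary G) {ω : Tape P n}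
    (hω : EarlyInteresting G ω) (v : Fin n) :
    (final adv ω v).label = lab G (deadline P G) (order ω) v := by
  have hpiv : (mis (pruned adv ω) n v).pivot = false ↔
      ¬ IsPivot G (deadline P G) (order ω) v := by
    rw [← Bool.not_eq_true, pivot_mis h0 ha hX adv hω, and_iff_right (order ω v).2]
  have hbel : ∀ u, P.below n (mis (pruned adv ω) n u).pos (mis (pruned adv ω) n v).deg ↔
      (order ω u : ℕ) < deadline P G v := by
    intro u
    rw [pos_mis, deg_mis, pruned_pos h0 ha, pruned_deg h0 ha, ← order_add_one,
      below_iff hX (order ω u).2]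
    rfl
  have hfirst := isFirstPivot_iff h0 ha hX adv hω v
  have hhit : (mis (pruned adv ω) n v).pivot = false → ∀ u,
      IsFirstPivot (mis (pruned adv ω) n) v u → (order ω u : ℕ) < deadline P G v →
      Hits G (deadline P G) (order ω) u v := by
    intro hv u hu hlt
    rw [hpiv] at hv
    rw [hfirst] at hu
    refine ⟨hu.1.1, mem_alive.2 ⟨hlt, fun w hw hwu => ?_⟩, Or.inr hu.1.2⟩
    rintro (rfl | hadj)
    · exact hv hw
    · exact absurd hwu (not_lt.2 (hu.2 w hw hadj))
  have hlabel : (final adv ω v).label =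
      if h : (mis (pruned adv ω) n v).pivot = false ∧
        ∃ u, IsFirstPivot (mis (pruned adv ω) n) v u ∧
          P.below n (mis (pruned adv ω) n u).pos (mis (pruned adv ω) n v).deg
      then h.2.choose else v := rfl
  rw [hlabel]
  split_ifs with h
  · have hs := h.2.choose_spec
    exact ((hhit h.1 _ hs.1 ((hbel _).1 hs.2)).lab_eq).symm
  · by_cases hex : ∃ w, Hits G (deadline P G) (order ω) w v
    · obtain ⟨w, hw⟩ := hex
      rw [hw.lab_eq]
      by_contra hne
      have hadj : G.Adj w v := hw.2.2.resolve_left hne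
      refine h ⟨hpiv.2 fun hv => hne (hv.hits.unique hw), w,
        (hfirst w).2 ⟨⟨hw.1, hadj⟩, fun w' hw' hadj' => ?_⟩,
        (hbel w).2 (mem_alive.1 hw.2.1).1⟩
      by_contra! hlt
      exact (mem_alive.1 hw.2.1).2 w' hw' hlt (Or.inr hadj')
    · exact (TimedOut.lab_eq hex).symm

lemma output_eq (h0 : 1 ≤ P.theta0 n) (ha : 1 ≤ P.a)
    (hX : 0 < P.c / P.ε * (n * Real.logb 2 n)) (adv : Adversary G) {ω : Tape P n}
    (hω : EarlyInteresting G ω) :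
    output adv ω = Setoid.ker (lab G (deadline P G) (order ω)) := by
  unfold output
  congr 1
  funext v
  exact final_label h0 ha hX adv hω v

end Output

/-! ### Tail bounds and symmetry for uniform tapes -/

section Tapes

variable {P : Params} {n : ℕ}

/-- The tapes for which there are no ties between ranks. -/
def tieFree (P : Params) (n : ℕ) : Finset (Tape P n) :=
  univ.filter fun ω => Function.Injective ω

/-- Without ties, the order of the ranks is uniformly distributed. -/
lemma sum_order (f : Equiv.Perm (Fin n) → ℝ) :
    n.factorial * ∑ ω ∈ tieFree P n, f (order ω) = (tieFree P n).card * ∑ σ, f σ := by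
  -- Permuting the rows is a bijection of the tie-free tapes; averaging over all ρ makes the order
  -- uniform.
  have h1 : ∀ ρ : Equiv.Perm (Fin n), ∑ ω ∈ tieFree P n, f (order ω * ρ) =
      ∑ ω ∈ tieFree P n, f (order ω) := by
    intro ρ
    refine sum_bij' (fun ω _ => (ω ∘ ρ : Tape P n)) (fun ω _ => (ω ∘ ρ.symm : Tape P n)) ?_ ?_ ?_ ?_ ?_
    · intro ω h
      exact mem_filter.2 ⟨mem_univ _, (mem_filter.1 h).2.comp ρ.injective⟩
    · intro ω h
      exact mem_filter.2 ⟨mem_univ _, (mem_filter.1 h).2.comp ρ.symm.injective⟩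
    · intro ω _
      funext u
      simp
    · intro ω _
      funext u
      simp
    · intro ω h
      rw [order_comp (mem_filter.1 h).2]
  calc n.factorial * ∑ ω ∈ tieFree P n, f (order ω)
      = ∑ ρ : Equiv.Perm (Fin n), ∑ ω ∈ tieFree P n, f (order ω * ρ) := by
        rw [sum_congr rfl fun ρ _ => h1 ρ, sum_const, card_univ, Fintype.card_perm,
          Fintype.card_fin, nsmul_eq_mul]
    _ = ∑ ω ∈ tieFree P n, ∑ ρ, f (order ω * ρ) := sum_comm
    _ = ∑ ω ∈ tieFree P n, ∑ σ, f σ :=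
        sum_congr rfl fun ω _ => Equiv.sum_comp (Equiv.mulLeft (order ω)) f
    _ = _ := by rw [sum_const, nsmul_eq_mul]

/-- Overwriting row u by an arbitrary row is injective here, because the lost row can still be read
at v. -/
lemma card_tie_mul_le {u v : Fin n} (huv : u ≠ v) :
    (univ.filter fun ω : Tape P n => ω u = ω v).card * 2 ^ P.len n ≤
      Fintype.card (Tape P n) := by
  have hR : Fintype.card (Fin (P.len n) → Bool) = 2 ^ P.len n := by simp
  rw [← hR, ← card_univ (α := Fin (P.len n) → Bool), ← card_product, ← card_univ]
  refine card_le_card_of_injOn (fun p => Function.update p.1 u p.2) (fun _ _ => mem_coe.2 (mem_univ _)) ?_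
  rintro ⟨ω, r⟩ h ⟨ω', r'⟩ h' he
  replace h := (mem_filter.1 (mem_product.1 (mem_coe.1 h)).1).2
  replace h' := (mem_filter.1 (mem_product.1 (mem_coe.1 h')).1).2
  simp only at he h h'
  have hx : ∀ x, x ≠ u → ω x = ω' x := by
    intro x hx
    have := congrFun he x
    rwa [Function.update_of_ne hx, Function.update_of_ne hx] at this
  have hr := congrFun he u
  rw [Function.update_self, Function.update_self] at hr
  have hω : ω = ω' := by
    funext x
    by_cases hxu : x = u
    · rw [hxu, h, h', hx v huv.symm]
    · exact hx x hxu
  rw [hω, hr]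

lemma card_ties_mul_le (P : Params) (n : ℕ) :
    (univ.filter fun ω : Tape P n => ¬ Function.Injective ω).card * 2 ^ P.len n ≤
      n * n * Fintype.card (Tape P n) := by
  have hsub : (univ.filter fun ω : Tape P n => ¬ Function.Injective ω) ⊆
      (univ.filter fun p : Fin n × Fin n => p.1 ≠ p.2).biUnion fun p =>
        univ.filter fun ω : Tape P n => ω p.1 = ω p.2 := by
    intro ω h
    replace h := (mem_filter.1 h).2
    unfold Function.Injective at h
    push Not at h
    obtain ⟨u, v, h1, h2⟩ := h
    exact mem_biUnion.2 ⟨(u, v), mem_filter.2 ⟨mem_univ _, h2⟩, mem_filter.2 ⟨mem_univ _, h1⟩⟩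
  have h1 := Nat.mul_le_mul_right (2 ^ P.len n) ((card_le_card hsub).trans card_biUnion_le)
  refine h1.trans ?_
  rw [sum_mul]
  refine (sum_le_sum fun p hp => card_tie_mul_le (mem_filter.1 hp).2).trans ?_
  rw [sum_const, smul_eq_mul]
  refine Nat.mul_le_mul_right _ ((card_le_univ _).trans ?_)
  simp

/-- The number of nodes whose first `j` rank bits are zero. -/
def numPrefixZero (ω : Tape P n) (j : ℕ) : ℕ := (univ.filter fun u => PrefixZero ω u j).card

lemma card_rows (N j : ℕ) :
    (univ.filter fun r : Fin N → Bool => ∀ i : Fin N, (i : ℕ) < j → r i = false).card =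
      2 ^ (N - j) := by
  have h : (univ.filter fun r : Fin N → Bool => ∀ i : Fin N, (i : ℕ) < j → r i = false) =
      Fintype.piFinset fun i : Fin N => if (i : ℕ) < j then {false} else univ := by
    ext r
    simp only [mem_filter, mem_univ, true_and, Fintype.mem_piFinset]
    refine forall_congr' fun i => ?_
    split_ifs with h <;> simp [h]
  have hc : ∀ i : Fin N, (if (i : ℕ) < j then ({false} : Finset Bool) else univ).card =
      if (i : ℕ) < j then 1 else 2 := by
    intro i
    split_ifs <;> simp
  rw [h, Fintype.card_piFinset, prod_congr rfl fun i _ => hc i,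
    Fin.prod_univ_eq_prod_range (fun i => if i < j then 1 else 2) N, prod_ite, prod_const_one,
    one_mul, prod_const]
  congr 1
  have : (range N).filter (fun i => ¬ i < j) = Ico j N := by
    ext i
    simp only [mem_filter, mem_range, mem_Ico]
    omega
  rw [this, Nat.card_Ico]

lemma sum_half_pow_numPrefixZero {j : ℕ} (hj : j ≤ P.len n) :
    ∑ ω : Tape P n, (1 / 2 : ℝ) ^ numPrefixZero ω j =
      Fintype.card (Tape P n) * (1 - 1 / 2 ^ (j + 1)) ^ n := by
  let f : (Fin (P.len n) → Bool) → ℝ := fun r =>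
    if ∀ i : Fin (P.len n), (i : ℕ) < j → r i = false then 1 / 2 else 1
  have h1 : ∀ ω : Tape P n, (1 / 2 : ℝ) ^ numPrefixZero ω j = ∏ u, f (ω u) := by
    intro ω
    simp only [f]
    rw [prod_ite, prod_const, prod_const_one, mul_one]
    simp only [numPrefixZero, PrefixZero]
    congr
  have h2 : ∑ r, f r = 2 ^ P.len n * (1 - 1 / 2 ^ (j + 1)) := by
    have h3 : ∀ r, f r =
        1 - if ∀ i : Fin (P.len n), (i : ℕ) < j → r i = false then 1 / 2 else 0 := by
      intro r
      simp only [f]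
      split_ifs <;> norm_num
    rw [sum_congr rfl fun r _ => h3 r, sum_sub_distrib, ← sum_filter, sum_const, sum_const,
      card_rows, card_univ]
    obtain ⟨m, hm⟩ := Nat.exists_eq_add_of_le hj
    rw [hm, Nat.add_sub_cancel_left]
    simp
    field_simp
    ring
  rw [sum_congr rfl fun ω _ => h1 ω]
  have h3 := prod_univ_sum (fun _ : Fin n => (univ : Finset (Fin (P.len n) → Bool)))
    (fun _ r => f r)
  rw [Fintype.piFinset_univ] at h3
  rw [← h3, prod_const, h2, card_univ, Fintype.card_fin, mul_pow]
  simp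

/-- A lower tail bound for the number of nodes whose first bits are zero. -/
lemma card_few_prefixZero_le {j : ℕ} (hj : j ≤ P.len n) :
    ((univ.filter fun ω : Tape P n => (numPrefixZero ω j : ℝ) < n / 2 ^ (j + 1)).card : ℝ) ≤
      Real.exp (-(3 / 20 * (n / 2 ^ j))) * Fintype.card (Tape P n) := by
  set B := univ.filter fun ω : Tape P n => (numPrefixZero ω j : ℝ) < n / 2 ^ (j + 1)
  set μ : ℝ := n / 2 ^ j with hμ
  have hμ2 : (n : ℝ) / 2 ^ (j + 1) = μ / 2 := by
    rw [hμ, pow_succ]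
    field_simp
  have hμ0 : 0 ≤ μ := by positivity
  -- Markov for 2^{-N} with N = `numPrefixZero ω j`: on `B` it is at least 2^{-μ/2} ≥ e^{-7μ/20}, as
  -- (log 2)/2 < 7/20, and its mean is at most e^{-μ/2}. The difference of the exponents is 3/20.
  have h1 : B.card * Real.exp (-(7 / 20 * μ)) ≤
      Fintype.card (Tape P n) * Real.exp (-(μ / 2)) := by
    calc B.card * Real.exp (-(7 / 20 * μ)) = ∑ ω ∈ B, Real.exp (-(7 / 20 * μ)) := by
          rw [sum_const, nsmul_eq_mul]
      _ ≤ ∑ ω ∈ B, (1 / 2 : ℝ) ^ numPrefixZero ω j := by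
          refine sum_le_sum fun ω hω => ?_
          have hlt := (mem_filter.1 hω).2
          rw [hμ2] at hlt
          have h2 : (1 / 2 : ℝ) ^ numPrefixZero ω j =
              Real.exp (-(Real.log 2 * numPrefixZero ω j)) := by
            rw [Real.exp_neg, mul_comm, Real.exp_nat_mul, Real.exp_log two_pos, one_div, inv_pow]
          rw [h2, Real.exp_le_exp]
          have := Real.log_two_lt_d9
          have := Real.log_two_gt_d9
          nlinarith
      _ ≤ ∑ ω : Tape P n, (1 / 2 : ℝ) ^ numPrefixZero ω j :=
          sum_le_sum_of_subset_of_nonneg (subset_univ _) fun ω _ _ => by positivity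
      _ = Fintype.card (Tape P n) * (1 - 1 / 2 ^ (j + 1)) ^ n := sum_half_pow_numPrefixZero hj
      _ ≤ Fintype.card (Tape P n) * Real.exp (-(μ / 2)) := by
          refine mul_le_mul_of_nonneg_left ?_ (Nat.cast_nonneg _)
          have h2 : 1 - 1 / (2 : ℝ) ^ (j + 1) ≤ Real.exp (-(1 / 2 ^ (j + 1))) := by
            have := Real.add_one_le_exp (-(1 / (2 : ℝ) ^ (j + 1)))
            linarith
          have h3 : 0 ≤ 1 - 1 / (2 : ℝ) ^ (j + 1) := by
            rw [sub_nonneg, div_le_one (by positivity)]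
            exact one_le_pow₀ one_le_two
          refine (pow_le_pow_left₀ h3 h2 n).trans (le_of_eq ?_)
          rw [← Real.exp_nat_mul, ← hμ2]
          congr 1
          ring
  have h2 : Real.exp (-(μ / 2)) = Real.exp (-(3 / 20 * μ)) * Real.exp (-(7 / 20 * μ)) := by
    rw [← Real.exp_add]
    congr 1
    ring
  rw [h2, ← mul_assoc] at h1
  have := le_of_mul_le_mul_right h1 (Real.exp_pos _)
  linarith

end Tapes

/-! ### The events under which the simulation is exact and timeouts are cheap -/

section GoodEvents

variable {P : Params} {n : ℕ} {G : SimpleGraph (Fin n)}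

lemma le_theta0 (P : Params) (n : ℕ) : 4 * P.c / P.ε * Real.logb 2 n ≤ P.theta0 n :=
  Nat.le_ceil _

/-- Class i + 1 means degree above 2^i θ_0, so π·deg is at least nθ_0/4. The factor 4 in θ_0 is used
up here. -/
lemma not_below_of_le {ω : Tape P n} (h0 : 1 ≤ P.theta0 n) {u : Fin n} {i : ℕ}
    (hi : P.degClass n (G.degree u) = i + 1)
    (hpos : (n : ℝ) / 2 ^ (i + 2) ≤ position ω u) :
    ¬ P.below n (position ω u) (G.degree u) := by
  unfold Params.below
  rw [not_lt]
  have h1 : (2 : ℝ) ^ i * P.theta0 n ≤ G.degree u := by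
    exact_mod_cast (lt_of_degClass_eq_succ h0 hi).le
  have h2 := le_theta0 P n
  calc P.c / P.ε * (n * Real.logb 2 n)
      = n / 2 ^ (i + 2) * (2 ^ i * (4 * P.c / P.ε * Real.logb 2 n)) := by
        rw [pow_add]
        field_simp
        ring
    _ ≤ n / 2 ^ (i + 2) * (2 ^ i * P.theta0 n) := by gcongr
    _ ≤ position ω u * G.degree u := by gcongr

/-- A node of class j with a 1 among its first j bits comes after all nodes with j leading zeros. If
there are at least n/2^{j+1} of them, half of the mean, its position exceeds its τ. The mean n/2^j
is at least θ_0/2, since the class is occupied by a degree below n; this turns 3/20 into 3/40. -/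
lemma card_not_earlyInteresting_le (h0 : 1 ≤ P.theta0 n) (ha : 1 ≤ P.a)
    (G : SimpleGraph (Fin n)) :
    ((univ.filter fun ω : Tape P n => ¬ EarlyInteresting G ω).card : ℝ) ≤
      n * (Real.exp (-(3 / 40 * P.theta0 n)) * Fintype.card (Tape P n)) := by
  let F : Fin n → Finset (Tape P n) := fun u => univ.filter fun ω =>
    P.degClass n (G.degree u) ≠ 0 ∧ (numPrefixZero ω (P.degClass n (G.degree u)) : ℝ) <
      n / 2 ^ (P.degClass n (G.degree u) + 1)
  have hsub : (univ.filter fun ω : Tape P n => ¬ EarlyInteresting G ω) ⊆ univ.biUnion F := by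
    intro ω hω
    replace hω := (mem_filter.1 hω).2
    unfold EarlyInteresting at hω
    push Not at hω
    obtain ⟨u, hb, hz⟩ := hω
    refine mem_biUnion.2 ⟨u, mem_univ _, mem_filter.2 ⟨mem_univ _, ?_, ?_⟩⟩
    · intro h
      rw [h] at hz
      exact hz fun i hi => absurd hi (Nat.not_lt_zero _)
    · by_contra! hle
      rcases hi : P.degClass n (G.degree u) with _ | i
      · rw [hi] at hz
        exact hz fun i hi => absurd hi (Nat.not_lt_zero _)
      · refine not_below_of_le h0 hi ?_ hb
        rw [hi] at hle hz
        refine hle.trans (Nat.cast_le.2 (card_le_card fun v hv => ?_))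
        have hl := degClass_le_len h0 ha (degree_lt G u)
        rw [hi] at hl
        exact mem_filter.2 ⟨mem_univ _, Or.inl
          (rankNum_lt_of_prefixZero hl (mem_filter.1 hv).2 hz)⟩
  have hF : ∀ u, ((F u).card : ℝ) ≤
      Real.exp (-(3 / 40 * P.theta0 n)) * Fintype.card (Tape P n) := by
    intro u
    rcases hi : P.degClass n (G.degree u) with _ | i
    · have : F u = ∅ := filter_eq_empty_iff.2 fun ω _ h => h.1 hi
      rw [this, card_empty, Nat.cast_zero]
      positivity
    · have hl := degClass_le_len h0 ha (degree_lt G u)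
      have h1 : (F u).card ≤ (univ.filter fun ω : Tape P n =>
          (numPrefixZero ω (P.degClass n (G.degree u)) : ℝ) <
            n / 2 ^ (P.degClass n (G.degree u) + 1)).card :=
        card_le_card fun ω h => mem_filter.2 ⟨mem_univ _, (mem_filter.1 h).2.2⟩
      refine (Nat.cast_le.2 h1).trans ((card_few_prefixZero_le hl).trans ?_)
      refine mul_le_mul_of_nonneg_right (Real.exp_le_exp.2 ?_) (Nat.cast_nonneg _)
      have h2 : (2 : ℝ) ^ i * P.theta0 n ≤ n := by
        exact_mod_cast ((lt_of_degClass_eq_succ h0 hi).trans (degree_lt G u)).le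
      have h3 : (P.theta0 n : ℝ) / 2 ≤ n / 2 ^ P.degClass n (G.degree u) := by
        rw [hi, div_le_div_iff₀ two_pos (by positivity), pow_succ]
        linarith
      linarith
  have h1 := (card_le_card hsub).trans card_biUnion_le
  calc _ ≤ ((∑ u, (F u).card : ℕ) : ℝ) := by exact_mod_cast h1
    _ = ∑ u, ((F u).card : ℝ) := by push_cast; rfl
    _ ≤ ∑ _u : Fin n, Real.exp (-(3 / 40 * P.theta0 n)) * Fintype.card (Tape P n) :=
        sum_le_sum fun u _ => hF u
    _ = _ := by rw [sum_const, card_univ, Fintype.card_fin, nsmul_eq_mul]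

/-- The orders for which some node times out while it has many unclustered neighbours. -/
def badOrders (P : Params) (G : SimpleGraph (Fin n)) : Finset (Equiv.Perm (Fin n)) :=
  univ.filter fun σ => ¬ ∀ x, x ∈ alive G (deadline P G) σ (deadline P G x - 1) →
    ((univ.filter fun y => G.Adj x y ∧
      y ∈ alive G (deadline P G) σ (deadline P G x - 1)).card : ℝ) ≤ P.ε / 20 * G.degree x

/-- Rounding and the two shifts cost at most 2, which is at most τ/2 once τ ≥ 4. -/
lemma half_le_timeout {d : ℕ} (hd : d ≠ 0)
    (h4 : 4 ≤ P.c / P.ε * (n * Real.logb 2 n) / d) :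
    P.c / P.ε * (n * Real.logb 2 n) / d / 2 ≤ (timeout P n d - 1 : ℕ) := by
  rw [timeout, if_neg hd]
  set τ := P.c / P.ε * (n * Real.logb 2 n) / d
  have h1 : τ ≤ ⌈τ⌉₊ := Nat.le_ceil τ
  have h2 : (⌈τ⌉₊ : ℝ) ≤ ((⌈τ⌉₊ - 1 - 1 : ℕ) : ℝ) + 2 := by
    exact_mod_cast (by omega : ⌈τ⌉₊ ≤ ⌈τ⌉₊ - 1 - 1 + 2)
  linarith

lemma four_le (hε : 0 < P.ε) (hε1 : P.ε < 1) (hc : 4 ≤ P.c) (hn : 2 ≤ n) {d : ℕ} (hd : d ≠ 0)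
    (hdn : d < n) : 4 ≤ P.c / P.ε * (n * Real.logb 2 n) / d := by
  have hd' : (0 : ℝ) < d := by exact_mod_cast Nat.pos_of_ne_zero hd
  have hdn' : (d : ℝ) ≤ n := by exact_mod_cast hdn.le
  have hL : 1 ≤ Real.logb 2 n := by
    rw [Real.le_logb_iff_rpow_le one_lt_two (by positivity), Real.rpow_one]
    exact_mod_cast hn
  have h1 : 4 ≤ P.c / P.ε := by
    rw [le_div_iff₀ hε]
    nlinarith
  rw [le_div_iff₀ hd']
  have h2 : (n : ℝ) ≤ n * Real.logb 2 n := le_mul_of_one_le_right (Nat.cast_nonneg _) hL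
  have h3 : 4 * (d : ℝ) ≤ 4 * (n * Real.logb 2 n) := by linarith
  exact h3.trans (mul_le_mul_of_nonneg_right h1 (by positivity))

lemma deadline_pos (hε : 0 < P.ε) (hε1 : P.ε < 1) (hc : 4 ≤ P.c) (hn : 2 ≤ n) (v : Fin n) :
    0 < deadline P G v := by
  unfold deadline
  by_cases hd : G.degree v = 0
  · rw [timeout, if_pos hd]
    omega
  · have h4 := four_le hε hε1 hc hn hd (degree_lt G v)
    have h := half_le_timeout hd h4
    have : (0 : ℝ) < (timeout P n (G.degree v) - 1 : ℕ) := by linarith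
    have : 0 < timeout P n (G.degree v) - 1 := by exact_mod_cast this
    omega

/-- `card_lateOrders_le` with β = (ε/20)·deg and a time of at least τ/2: degree, ε and n cancel in
β·t/n, leaving (c/40) log n. -/
lemma card_badOrders_le (hε : 0 < P.ε) (hε1 : P.ε < 1) (hc : 4 ≤ P.c) (hn : 2 ≤ n)
    (G : SimpleGraph (Fin n)) :
    ((badOrders P G).card : ℝ) ≤
      n * (Real.exp (-(P.c / 40 * Real.logb 2 n)) * n.factorial) := by
  let F : Fin n → Finset (Equiv.Perm (Fin n)) := fun x => univ.filter fun σ =>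
    G.degree x ≠ 0 ∧ deadline P G x - 1 < n ∧
      σ ∈ lateOrders G (deadline P G) x (P.ε / 20 * G.degree x) (deadline P G x - 1)
  have hsub : badOrders P G ⊆ univ.biUnion F := by
    intro σ hσ
    replace hσ := (mem_filter.1 hσ).2
    push Not at hσ
    obtain ⟨x, hx, hlt⟩ := hσ
    refine mem_biUnion.2 ⟨x, mem_univ _, mem_filter.2 ⟨mem_univ _, ?_, ?_, ?_⟩⟩
    · intro hd
      have h1 : (univ.filter fun y => G.Adj x y ∧
          y ∈ alive G (deadline P G) σ (deadline P G x - 1)).card ≤ G.degree x := by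
        refine card_le_card fun y hy => ?_
        rw [SimpleGraph.mem_neighborFinset]
        exact (mem_filter.1 hy).2.1
      rw [hd, Nat.cast_zero, mul_zero] at hlt
      rw [hd] at h1
      have : 0 < (univ.filter fun y => G.Adj x y ∧
          y ∈ alive G (deadline P G) σ (deadline P G x - 1)).card := by exact_mod_cast hlt
      omega
    · exact (le_of_mem_alive hx).trans_lt (σ x).2
    · exact mem_filter.2 ⟨mem_univ _, hx, hlt.le⟩
  have hn0 : (0 : ℝ) < n := by positivity
  have hF : ∀ x, ((F x).card : ℝ) ≤
      Real.exp (-(P.c / 40 * Real.logb 2 n)) * n.factorial := by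
    intro x
    by_cases h : G.degree x ≠ 0 ∧ deadline P G x - 1 < n
    · have h1 : (F x).card ≤ (lateOrders G (deadline P G) x (P.ε / 20 * G.degree x)
          (deadline P G x - 1)).card := card_le_card fun σ h => (mem_filter.1 h).2.2.2
      refine (Nat.cast_le.2 h1).trans ((card_lateOrders_le x _ h.2.le).trans ?_)
      refine mul_le_mul_of_nonneg_right (Real.exp_le_exp.2 (neg_le_neg ?_)) (Nat.cast_nonneg _)
      have h2 := half_le_timeout h.1 (four_le hε hε1 hc hn h.1 (degree_lt G x))
      have hd' : (0 : ℝ) < G.degree x := by exact_mod_cast Nat.pos_of_ne_zero h.1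
      calc P.c / 40 * Real.logb 2 n = P.ε / 20 * G.degree x *
            (P.c / P.ε * (n * Real.logb 2 n) / G.degree x / 2) / n := by
            field_simp
            ring
        _ ≤ P.ε / 20 * G.degree x * (deadline P G x - 1 : ℕ) / n := by
            unfold deadline
            gcongr
    · have : F x = ∅ := filter_eq_empty_iff.2 fun σ _ h' => h ⟨h'.1, h'.2.1⟩
      rw [this, card_empty, Nat.cast_zero]
      positivity
  have h1 := (card_le_card hsub).trans card_biUnion_le
  calc _ ≤ ((∑ u, (F u).card : ℕ) : ℝ) := by exact_mod_cast h1
    _ = ∑ u, ((F u).card : ℝ) := by push_cast; rfl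
    _ ≤ ∑ _u : Fin n, Real.exp (-(P.c / 40 * Real.logb 2 n)) * n.factorial :=
        sum_le_sum fun u _ => hF u
    _ = _ := by rw [sum_const, card_univ, Fintype.card_fin, nsmul_eq_mul]

end GoodEvents

/-! ### Constants and final estimates -/

section Bounds

variable {P : Params} {n : ℕ} {G : SimpleGraph (Fin n)}

lemma one_le_logb (hn : 2 ≤ n) : 1 ≤ Real.logb 2 n := by
  rw [Real.le_logb_iff_rpow_le one_lt_two (by positivity), Real.rpow_one]
  exact_mod_cast hn

lemma exp_neg_mul_logb_le (hn : 2 ≤ n) {m : ℕ} {c : ℝ} (hc : m ≤ c) :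
    Real.exp (-(c * Real.logb 2 n)) ≤ 1 / (n : ℝ) ^ m := by
  have hn0 : (0 : ℝ) < n := by positivity
  have hlog : 0 ≤ Real.log n := Real.log_natCast_nonneg n
  have h1 : Real.log n ≤ Real.logb 2 n := by
    rw [Real.logb, le_div_iff₀ (Real.log_pos one_lt_two)]
    have := Real.log_two_lt_d9
    nlinarith
  have h2 : m * Real.log n ≤ c * Real.logb 2 n :=
    mul_le_mul hc h1 hlog ((Nat.cast_nonneg m).trans hc)
  calc Real.exp (-(c * Real.logb 2 n)) ≤ Real.exp (-(m * Real.log n)) :=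
        Real.exp_le_exp.2 (neg_le_neg h2)
    _ = 1 / (n : ℝ) ^ m := by
        rw [Real.exp_neg, Real.exp_nat_mul, Real.exp_log hn0, one_div]

lemma mul_logb_le_theta0 (hε : 0 < P.ε) (hε4 : P.ε < 1 / 4) (hc : 0 ≤ P.c) (hn : 2 ≤ n) :
    16 * P.c * Real.logb 2 n ≤ P.theta0 n := by
  refine le_trans ?_ (le_theta0 P n)
  refine mul_le_mul_of_nonneg_right ?_ (zero_le_one.trans (one_le_logb hn))
  rw [le_div_iff₀ hε]
  nlinarith

lemma one_le_theta0 (hε : 0 < P.ε) (hε4 : P.ε < 1 / 4) (hc : 1 ≤ P.c) (hn : 2 ≤ n) :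
    1 ≤ P.theta0 n := by
  have h1 := mul_logb_le_theta0 hε hε4 (by linarith) hn
  have h2 := one_le_logb hn
  have : (1 : ℝ) ≤ P.theta0 n := by nlinarith
  exact_mod_cast this

lemma pow_le_two_pow_len (hn : 2 ≤ n) : (n : ℝ) ^ P.a ≤ 2 ^ P.len n := by
  have hn0 : (0 : ℝ) < n := by positivity
  calc (n : ℝ) ^ P.a = ((2 : ℝ) ^ Real.logb 2 n) ^ P.a := by
        rw [Real.rpow_logb two_pos (by norm_num) hn0]
    _ = (2 : ℝ) ^ ((P.a : ℝ) * Real.logb 2 n) := by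
        rw [← Real.rpow_natCast, ← Real.rpow_mul two_pos.le, mul_comm]
    _ ≤ (2 : ℝ) ^ (P.len n : ℝ) := Real.rpow_le_rpow_of_exponent_le one_le_two (Nat.le_ceil _)
    _ = 2 ^ P.len n := Real.rpow_natCast _ _

/-- The tapes without ties for which the algorithm simulates the sequential greedy process and
timeouts are cheap. -/
def goodTapes (P : Params) (G : SimpleGraph (Fin n)) : Finset (Tape P n) :=
  univ.filter fun ω => Function.Injective ω ∧ EarlyInteresting G ω ∧ order ω ∉ badOrders P G

lemma card_order_mem_le (S : Finset (Equiv.Perm (Fin n))) :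
    (n.factorial : ℝ) * ((tieFree P n).filter fun ω => order ω ∈ S).card ≤
      Fintype.card (Tape P n) * S.card := by
  have h := sum_order (P := P) fun σ => if σ ∈ S then (1 : ℝ) else 0
  rw [← sum_filter, ← sum_filter, sum_const, sum_const, nsmul_one, nsmul_one,
    filter_univ_mem] at h
  rw [h]
  exact mul_le_mul_of_nonneg_right (Nat.cast_le.2 (card_le_univ _)) (Nat.cast_nonneg _)

/-- Ties, early loss of interest and bad orders each have probability at most n^{-(k+5)}. The first
needs a ≥ k + 7 for n² pairs; the last, a union over n nodes with exponent c/40, dictates c ≥ 40(k +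
6). -/
lemma card_compl_goodTapes_le (hε : 0 < P.ε) (hε4 : P.ε < 1 / 4) {k : ℕ}
    (hc : 40 * (k + 6) ≤ P.c) (ha : k + 7 ≤ P.a) (hn : 2 ≤ n) (G : SimpleGraph (Fin n)) :
    (((goodTapes P G)ᶜ).card : ℝ) ≤ 3 / (n : ℝ) ^ (k + 5) * Fintype.card (Tape P n) := by
  have hn0 : (0 : ℝ) < n := by positivity
  have hn1 : (1 : ℝ) ≤ n := by exact_mod_cast (by omega : 1 ≤ n)
  have hk : (0 : ℝ) ≤ k := Nat.cast_nonneg k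
  have h0 : 1 ≤ P.theta0 n := one_le_theta0 hε hε4 (by linarith) hn
  set N : ℝ := (Fintype.card (Tape P n) : ℝ) with hN
  have hN0 : 0 ≤ N := Nat.cast_nonneg _
  set A := univ.filter fun ω : Tape P n => ¬ Function.Injective ω
  set B := univ.filter fun ω : Tape P n => ¬ EarlyInteresting G ω
  set C := (tieFree P n).filter fun ω => order ω ∈ badOrders P G
  have hsub : (goodTapes P G)ᶜ ⊆ A ∪ (B ∪ C) := by
    intro ω hω
    simp only [goodTapes, mem_compl, mem_filter, mem_univ, true_and, A, B, C, mem_union,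
      tieFree] at hω ⊢
    tauto
  have hcard : (((goodTapes P G)ᶜ).card : ℝ) ≤ A.card + (B.card + C.card) := by
    have h1 := card_le_card hsub
    have h2 := card_union_le A (B ∪ C)
    have h3 := card_union_le B C
    exact_mod_cast (by omega : ((goodTapes P G)ᶜ).card ≤ A.card + (B.card + C.card))
  have hA : (A.card : ℝ) ≤ 1 / (n : ℝ) ^ (k + 5) * N := by
    have h1 : (A.card : ℝ) * 2 ^ P.len n ≤ n * n * N := by
      rw [hN]
      exact_mod_cast card_ties_mul_le P n
    have h2 : (n : ℝ) ^ (k + 7) ≤ 2 ^ P.len n :=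
      (pow_le_pow_right₀ hn1 ha).trans (pow_le_two_pow_len hn)
    have h3 : (A.card : ℝ) * n ^ (k + 7) ≤ n * n * N :=
      (mul_le_mul_of_nonneg_left h2 (Nat.cast_nonneg _)).trans h1
    rw [div_mul_eq_mul_div, one_mul, le_div_iff₀ (by positivity)]
    refine le_of_mul_le_mul_right (a := (n : ℝ) * n) ?_ (by positivity)
    calc (A.card : ℝ) * n ^ (k + 5) * (n * n) = A.card * n ^ (k + 7) := by ring
      _ ≤ _ := by linarith
  have hpow : (n : ℝ) * (1 / n ^ (k + 6)) = 1 / n ^ (k + 5) := by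
    rw [pow_succ (n : ℝ) (k + 5)]
    field_simp
  have hB : (B.card : ℝ) ≤ 1 / (n : ℝ) ^ (k + 5) * N := by
    refine (card_not_earlyInteresting_le h0 (by omega) G).trans ?_
    rw [← mul_assoc, ← hpow]
    refine mul_le_mul_of_nonneg_right (mul_le_mul_of_nonneg_left ?_ hn0.le) hN0
    refine le_trans (Real.exp_le_exp.2 (neg_le_neg ?_))
      (exp_neg_mul_logb_le hn (m := k + 6) (c := P.c) (by push_cast; linarith))
    have h1 := mul_logb_le_theta0 hε hε4 (by linarith) hn
    have h2 : 0 ≤ P.c * Real.logb 2 n :=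
      mul_nonneg (by linarith) (zero_le_one.trans (one_le_logb hn))
    linarith
  have hC : (C.card : ℝ) ≤ 1 / (n : ℝ) ^ (k + 5) * N := by
    have h1 := card_order_mem_le (P := P) (badOrders P G)
    have h2 := card_badOrders_le hε (by linarith) (by linarith) hn G
    have h3 : Real.exp (-(P.c / 40 * Real.logb 2 n)) ≤ 1 / (n : ℝ) ^ (k + 6) :=
      exp_neg_mul_logb_le hn (by push_cast; linarith)
    have hf : (0 : ℝ) < n.factorial := by exact_mod_cast n.factorial_pos
    refine le_of_mul_le_mul_left ?_ hf
    refine h1.trans ?_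
    calc N * ((badOrders P G).card : ℝ)
        ≤ N * (n * (1 / (n : ℝ) ^ (k + 6) * n.factorial)) := by
          refine mul_le_mul_of_nonneg_left (h2.trans ?_) hN0
          gcongr
      _ = n.factorial * (n * (1 / (n : ℝ) ^ (k + 6)) * N) := by ring
      _ = _ := by rw [hpow]
  calc (((goodTapes P G)ᶜ).card : ℝ)
      ≤ 1 / (n : ℝ) ^ (k + 5) * N + (1 / (n : ℝ) ^ (k + 5) * N + 1 / (n : ℝ) ^ (k + 5) * N) := by
        linarith
    _ = _ := by ring

lemma cost_le_mul_self (s : Setoid (Fin n)) : cost G s ≤ n * n := by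
  refine (card_le_univ _).trans ?_
  simp

lemma cost_output_le (hε : 0 < P.ε) (hε4 : P.ε < 1 / 4) (hc : 4 ≤ P.c) (ha : 1 ≤ P.a)
    (hn : 2 ≤ n) (adv : Adversary G) {ω : Tape P n} (hω : ω ∈ goodTapes P G) :
    (1 - P.ε / 10) * (2 * (cost G (output adv ω) : ℝ)) ≤
      (chargedPairs G (deadline P G) (order ω)).card := by
  obtain ⟨_, h1, h2⟩ := (mem_filter.1 hω).2
  have h0 : 1 ≤ P.theta0 n := one_le_theta0 hε hε4 (by linarith) hn
  have hL := one_le_logb hn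
  have hX : 0 < P.c / P.ε * (n * Real.logb 2 n) := by
    have : 0 < P.c := by linarith
    positivity
  have h3 : ∀ x, x ∈ alive G (deadline P G) (order ω) (deadline P G x - 1) →
      ((univ.filter fun y => G.Adj x y ∧ y ∈ alive G (deadline P G) (order ω)
        (deadline P G x - 1)).card : ℝ) ≤ P.ε / 20 * G.degree x := by
    by_contra h
    exact h2 (mem_filter.2 ⟨mem_univ _, h⟩)
  rw [output_eq h0 ha hX adv h1]
  have := cost_lab_le (deadline_pos hε (by linarith) hc hn) (by positivity) h3
  rwa [show 1 - 2 * (P.ε / 20) = 1 - P.ε / 10 by ring] at this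

/-- Conditioning on goodness would destroy the uniformity of the order. Instead, the nonnegative
charge is summed over all tie-free tapes, where the order is uniform. -/
lemma sum_cost_goodTapes_le (hε : 0 < P.ε) (hε4 : P.ε < 1 / 4) (hc : 4 ≤ P.c) (ha : 1 ≤ P.a)
    (hn : 2 ≤ n) (adv : Adversary G) :
    (1 - P.ε / 10) * ∑ ω ∈ goodTapes P G, (cost G (output adv ω) : ℝ) ≤
      3 * (1 - 2 / n) * opt G * Fintype.card (Tape P n) := by
  have hn0 : (0 : ℝ) < n := by positivity
  have hf : (0 : ℝ) < n.factorial := by exact_mod_cast n.factorial_pos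
  set Z : Equiv.Perm (Fin n) → ℝ := fun σ => (chargedPairs G (deadline P G) σ).card with hZ
  have h1 : (1 - P.ε / 10) * (2 * ∑ ω ∈ goodTapes P G, (cost G (output adv ω) : ℝ)) ≤
      ∑ ω ∈ tieFree P n, Z (order ω) := by
    rw [mul_sum, mul_sum]
    refine (sum_le_sum fun ω hω => cost_output_le hε hε4 hc ha hn adv hω).trans ?_
    refine sum_le_sum_of_subset_of_nonneg ?_ fun ω _ _ => Nat.cast_nonneg _
    intro ω hω
    exact mem_filter.2 ⟨mem_univ _, (mem_filter.1 hω).2.1⟩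
  have h2 := sum_order (P := P) Z
  have h3 : n * ∑ σ, Z σ ≤ 6 * (n - 2) * n.factorial * opt G := by
    have := sum_card_chargedPairs_le (G := G) (T := deadline P G)
    have h' : ((n * ∑ σ, (chargedPairs G (deadline P G) σ).card : ℕ) : ℝ) ≤
        (6 * (n - 2) * n.factorial * opt G : ℕ) := by exact_mod_cast this
    push_cast [Nat.cast_sub hn] at h'
    exact h'
  have h4 : ∑ σ, Z σ ≤ 6 * (1 - 2 / n) * n.factorial * opt G := by
    refine le_of_mul_le_mul_left (h3.trans (le_of_eq ?_)) hn0
    field_simp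
  have h5 : ∑ ω ∈ tieFree P n, Z (order ω) ≤
      6 * (1 - 2 / n) * opt G * Fintype.card (Tape P n) := by
    refine le_of_mul_le_mul_left ?_ hf
    rw [h2]
    calc ((tieFree P n).card : ℝ) * ∑ σ, Z σ ≤ Fintype.card (Tape P n) * ∑ σ, Z σ :=
          mul_le_mul_of_nonneg_right (Nat.cast_le.2 (card_le_univ _))
            (sum_nonneg fun σ _ => Nat.cast_nonneg _)
      _ ≤ Fintype.card (Tape P n) * (6 * (1 - 2 / n) * n.factorial * opt G) :=
          mul_le_mul_of_nonneg_left h4 (Nat.cast_nonneg _)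
      _ = _ := by ring
  linarith

/-- The expected cost, up to the contribution of unlikely events. -/
lemma expectation_cost_le (hε : 0 < P.ε) (hε4 : P.ε < 1 / 4) {k : ℕ}
    (hc : 40 * (k + 6) ≤ P.c) (ha : k + 7 ≤ P.a) (hn : 2 ≤ n) (adv : Adversary G) :
    (1 - P.ε / 10) * expectation (fun ω : Tape P n => (cost G (output adv ω) : ℝ)) ≤
      3 / (n : ℝ) ^ (k + 3) + 3 * (1 - 2 / n) * opt G := by
  have hn0 : (0 : ℝ) < n := by positivity
  have hk : (0 : ℝ) ≤ k := Nat.cast_nonneg k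
  have hN : (0 : ℝ) < Fintype.card (Tape P n) := by exact_mod_cast Fintype.card_pos
  have h1 := sum_cost_goodTapes_le hε hε4 (by linarith) (by omega) hn adv
  have h2 : ∑ ω ∈ (goodTapes P G)ᶜ, (cost G (output adv ω) : ℝ) ≤
      3 / (n : ℝ) ^ (k + 3) * Fintype.card (Tape P n) := by
    calc ∑ ω ∈ (goodTapes P G)ᶜ, (cost G (output adv ω) : ℝ)
        ≤ ∑ _ω ∈ (goodTapes P G)ᶜ, (n * n : ℝ) :=
          sum_le_sum fun ω _ => by exact_mod_cast cost_le_mul_self _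
      _ = n * n * ((goodTapes P G)ᶜ).card := by rw [sum_const, nsmul_eq_mul, mul_comm]
      _ ≤ n * n * (3 / (n : ℝ) ^ (k + 5) * Fintype.card (Tape P n)) :=
          mul_le_mul_of_nonneg_left (card_compl_goodTapes_le hε hε4 hc ha hn G) (by positivity)
      _ = _ := by
          rw [pow_add (n : ℝ) k 5, pow_add (n : ℝ) k 3]
          field_simp
  have h3 : (1 - P.ε / 10) * ∑ ω ∈ (goodTapes P G)ᶜ, (cost G (output adv ω) : ℝ) ≤
      ∑ ω ∈ (goodTapes P G)ᶜ, (cost G (output adv ω) : ℝ) :=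
    mul_le_of_le_one_left (sum_nonneg fun ω _ => Nat.cast_nonneg _) (by linarith)
  have h4 := sum_add_sum_compl (goodTapes P G) fun ω => (cost G (output adv ω) : ℝ)
  unfold expectation
  rw [← mul_div_assoc, div_le_iff₀ hN, ← h4]
  linarith

lemma words_bound_le (hε : 0 < P.ε) (hε4 : P.ε < 1 / 4) (hc : 0 ≤ P.c) (hn : 2 ≤ n) :
    ((2 + 2 * (4 * n * P.theta0 n) + n * (P.a + 5) : ℕ) : ℝ) ≤
      (32 * P.c + P.a + 14) * (n * Real.logb 2 n / P.ε) := by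
  have hL := one_le_logb hn
  have hn2 : (2 : ℝ) ≤ n := by exact_mod_cast hn
  have h1 : (P.theta0 n : ℝ) ≤ 4 * P.c / P.ε * Real.logb 2 n + 1 :=
    (Nat.ceil_lt_add_one (by positivity)).le
  have h2 : (n : ℝ) ≤ n * Real.logb 2 n / P.ε := by
    rw [le_div_iff₀ hε]
    have := mul_le_mul_of_nonneg_left hL (Nat.cast_nonneg n)
    nlinarith
  push_cast
  calc (2 : ℝ) + 2 * (4 * n * P.theta0 n) + n * (P.a + 5)
      ≤ n + 2 * (4 * n * (4 * P.c / P.ε * Real.logb 2 n + 1)) + n * (P.a + 5) := by gcongr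
    _ = 32 * P.c * (n * Real.logb 2 n / P.ε) + (P.a + 14) * n := by ring
    _ ≤ 32 * P.c * (n * Real.logb 2 n / P.ε) + (P.a + 14) * (n * Real.logb 2 n / P.ε) := by
        gcongr
    _ = _ := by ring

lemma one_sub_le_probability {Ω : Type*} [Fintype Ω] [Nonempty Ω] {E : Ω → Prop} {S : Finset Ω}
    (h : ∀ ω ∉ S, E ω) : 1 - (S.card : ℝ) / Fintype.card Ω ≤ probability E := by
  have hN : (0 : ℝ) < Fintype.card Ω := by exact_mod_cast Fintype.card_pos
  have h1 : Sᶜ.card ≤ (univ.filter E).card :=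
    card_le_card fun ω hω => mem_filter.2 ⟨mem_univ _, h ω (mem_compl.1 hω)⟩
  have h2 : (S.card : ℝ) + Sᶜ.card = Fintype.card Ω := by exact_mod_cast card_add_card_compl S
  have h3 : (Sᶜ.card : ℝ) ≤ (univ.filter E).card := by exact_mod_cast h1
  unfold probability
  rw [le_div_iff₀ hN, sub_mul, div_mul_cancel₀ _ hN.ne']
  linarith

lemma probability_memory (hε : 0 < P.ε) (hε4 : P.ε < 1 / 4) {k : ℕ}
    (hc : 40 * (k + 6) ≤ P.c) (ha : 1 ≤ P.a) (hn : 2 ≤ n) (adv : Adversary G) :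
    1 - 1 / (n : ℝ) ^ k ≤ probability fun ω : Tape P n => ∀ m ∈ trace adv ω,
      (words m : ℝ) ≤ (32 * P.c + P.a + 14) * (n * Real.logb 2 n / P.ε) := by
  have hn0 : (0 : ℝ) < n := by positivity
  have hk : (0 : ℝ) ≤ k := Nat.cast_nonneg k
  have hN : (0 : ℝ) < Fintype.card (Tape P n) := by exact_mod_cast Fintype.card_pos
  have h0 : 1 ≤ P.theta0 n := one_le_theta0 hε hε4 (by linarith) hn
  refine le_trans ?_ (one_sub_le_probability (S := univ.filter fun ω : Tape P n =>
    ¬ ∀ m ∈ trace adv ω, words m ≤ 2 + 2 * (4 * n * P.theta0 n) + n * (P.a + 5))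
    fun ω hω m hm => ?_)
  swap
  · have h : ∀ m ∈ trace adv ω, words m ≤ 2 + 2 * (4 * n * P.theta0 n) + n * (P.a + 5) := by
      by_contra hc
      exact hω (mem_filter.2 ⟨mem_univ _, hc⟩)
    exact (Nat.cast_le.2 (h m hm)).trans (words_bound_le hε hε4 (by linarith) hn)
  refine sub_le_sub_left ((div_le_iff₀ hN).2
    ((card_large_memory_le h0 ha (by omega) adv).trans ?_)) _
  -- The union bound runs over one time per edge and the start.
  have h3 : (G.edgeFinset.card : ℝ) + 1 ≤ n ^ 3 := by
    have h4 : G.edgeFinset.card ≤ n ^ 2 := by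
      have h5 := G.card_edgeFinset_le_card_choose_two
      rw [Fintype.card_fin] at h5
      exact h5.trans (Nat.choose_le_pow n 2)
    have h5 : G.edgeFinset.card + 1 ≤ n ^ 3 := by nlinarith
    exact_mod_cast h5
  have h4 : Real.exp (-(P.theta0 n : ℝ)) ≤ 1 / (n : ℝ) ^ (k + 3) := by
    refine le_trans (Real.exp_le_exp.2 (neg_le_neg (mul_logb_le_theta0 hε hε4 (by linarith) hn)))
      (exp_neg_mul_logb_le hn ?_)
    push_cast
    linarith
  calc ((G.edgeFinset.card : ℝ) + 1) * (Real.exp (-(P.theta0 n : ℝ)) * Fintype.card (Tape P n))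
      ≤ n ^ 3 * (1 / (n : ℝ) ^ (k + 3) * Fintype.card (Tape P n)) := by gcongr
    _ = _ := by
        rw [pow_add]
        field_simp

/-- With z = 1/n, the error 3z³ is at most 6zy, the slack in 3(1 − 2z)y. Moreover (1 − ε/10)(3 + ε)
= 3 + ε(7 − ε)/10 ≥ 3. -/
lemma approximation_arith {ε x y z : ℝ} (hε : 0 < ε) (hε4 : ε < 1 / 4) (hz : 0 < z)
    (hz2 : z ≤ 1 / 2) (hy : 1 ≤ y)
    (h : (1 - ε / 10) * x ≤ 3 * z ^ 3 + 3 * (1 - 2 * z) * y) : x ≤ (3 + ε) * y := by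
  have h1 : z ^ 3 ≤ z := by
    have : z ^ 2 ≤ 1 := by nlinarith
    nlinarith
  have h2 : z ≤ z * y := le_mul_of_one_le_right hz.le hy
  have h3 : (1 - ε / 10) * x ≤ 3 * y := by nlinarith
  have h4 : 3 * y ≤ (1 - ε / 10) * ((3 + ε) * y) := by
    have : 0 ≤ ε * (7 - ε) * y := by
      have : 0 < 7 - ε := by linarith
      positivity
    nlinarith
  exact le_of_mul_le_mul_left (h3.trans h4) (by linarith)

end Bounds

end

end CorrClust

/-! ### Assembly of the theorem -/

theorem mainTheorem3 :
    ∀ k : ℕ, ∃ (c₀ : ℝ) (a₀ : ℕ), 0 < c₀ ∧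
      ∀ (c : ℝ) (a : ℕ), c₀ ≤ c → a₀ ≤ a →
        ∃ K : ℝ, 0 < K ∧
          ∀ (ε : ℝ), 0 < ε → ε < 1 / 4 →
          ∀ (n : ℕ), 2 ≤ n →
          ∀ (G : SimpleGraph (Fin n)) (adv : CorrClust.Adversary G),
            (1 ≤ CorrClust.opt G →
              CorrClust.expectation (fun ω : CorrClust.Tape ⟨ε, c, a⟩ n =>
                (CorrClust.cost G (CorrClust.output adv ω) : ℝ)) ≤
                  (3 + ε) * CorrClust.opt G) ∧
            (CorrClust.opt G = 0 →
              CorrClust.expectation (fun ω : CorrClust.Tape ⟨ε, c, a⟩ n =>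
                (CorrClust.cost G (CorrClust.output adv ω) : ℝ)) ≤ 1 / (n : ℝ) ^ k) ∧
            1 - 1 / (n : ℝ) ^ k ≤
              CorrClust.probability (fun ω : CorrClust.Tape ⟨ε, c, a⟩ n =>
                ∀ m ∈ CorrClust.trace adv ω,
                  (CorrClust.words m : ℝ) ≤ K * (n * Real.logb 2 n / ε)) := by
  intro k
  refine ⟨40 * (k + 6), k + 7, by positivity, fun c a hc ha => ?_⟩
  have hk : (0 : ℝ) ≤ k := Nat.cast_nonneg k
  have hc0 : 0 < c := by linarith
  refine ⟨32 * c + a + 14, by positivity, fun ε hε hε4 n hn G adv => ?_⟩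
  have hn2 : (2 : ℝ) ≤ n := by exact_mod_cast hn
  have hn0 : (0 : ℝ) < n := by linarith
  have hE := CorrClust.expectation_cost_le (P := ⟨ε, c, a⟩) hε hε4 hc ha hn adv
  refine ⟨fun hopt => ?_, fun hopt => ?_, ?_⟩
  · refine CorrClust.approximation_arith (z := 1 / n) hε hε4 (by positivity)
      (one_div_le_one_div_of_le two_pos hn2) (by exact_mod_cast hopt) (hE.trans ?_)
    have h1 : 3 / (n : ℝ) ^ (k + 3) ≤ 3 * (1 / n) ^ 3 := by
      rw [div_pow, one_pow, mul_one_div]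
      exact div_le_div_of_nonneg_left (by norm_num) (by positivity)
        (pow_le_pow_right₀ (by linarith) (by omega))
    have h2 : (2 : ℝ) / n = 2 * (1 / n) := by ring
    rw [h2]
    linarith
  · rw [hopt, Nat.cast_zero, mul_zero, add_zero] at hE
    -- Only failure events cost anything if OPT = 0, and n³ ≥ 8 absorbs both the 3 and the factor 1
    -- − ε/10.
    have h1 : 3 / (n : ℝ) ^ (k + 3) ≤ (1 - ε / 10) * (1 / n ^ k) := by
      have h3 : (8 : ℝ) ≤ n ^ 3 := by
        calc (8 : ℝ) = 2 ^ 3 := by norm_num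
          _ ≤ n ^ 3 := pow_le_pow_left₀ two_pos.le hn2 3
      rw [pow_add, mul_one_div, div_le_div_iff₀ (by positivity) (by positivity)]
      have h4 : 0 < (n : ℝ) ^ k := by positivity
      have h5 : 3 ≤ (1 - ε / 10) * n ^ 3 := by nlinarith
      nlinarith
    exact le_of_mul_le_mul_left (hE.trans h1) (by linarith)
  · exact CorrClust.probability_memory (P := ⟨ε, c, a⟩) hε hε4 hc (by simp only; omega) hn adv
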